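/- Conventions. A representation of a set $X$ is a partial surjection $\delta_X:\subseteq\mathbb{N}^{\mathbb{N}}\to X$; a represented space is a set with a representation, and $p$ is a name of $x$ if $\delta_X(p)=x$. Products $X\times Y$ carry the product representation with names $\langle p,q\rangle=(p(0),q(0),p(1),q(1),\dots)$, subsets of $\mathbb{N}^{\mathbb{N}}$ (in particular $2^{\mathbb{N}}=\{0,1\}^{\mathbb{N}}$ and $\mathbb{N}^{\mathbb{N}}$) carry the restriction of the identity, $\mathbb{N}$ is represented by $p\mapsto p(0)$, Sierpiński space $\mathbb{S}=\{0,1\}$ by $\delta_{\mathbb{S}}(p)=1\iff\exists n\;p(n)=0$, and $\mathbb{R}$ by the Cauchy representation (rapidly converging sequences of rationals). A (partial) multi-valued function $f:\subseteq X\rightrightarrows Y$ assigns to each $x\in X$ a set $f(x)\subseteq Y$, with $\operatorname{dom}(f)=\{x: f(x)\neq\emptyset\}$; the composition $f\circ g$ has domain $\{x\in\operatorname{dom}(g): g(x)\subseteq\operatorname{dom}(f)\}$ and values $(f\circ g)(x)=\bigcup_{y\in g(x)}f(y)$ there, and $(f\times g)(x,w)=f(x)\times g(w)$. A realizer of $f$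 is a partial function $F:\subseteq\mathbb{N}^{\mathbb{N}}\to\mathbb{N}^{\mathbb{N}}$ such that $F(p)$ is a name of an element of $f(x)$ whenever $p$ is a name of some $x\in\operatorname{dom}(f)$. A function between represented spaces is computable (continuous) if it has a computable (continuous) realizer. We write $f\leq_W g$ if there are computable $K,H:\subseteq\mathbb{N}^{\mathbb{N}}\to\mathbb{N}^{\mathbb{N}}$ such that $p\mapsto K\langle p,G(H(p))\rangle$ is a realizer of $f$ for every realizer $G$ of $g$. A set $C\subseteq X$ is closed if the characteristic function $\chi_{X\setminus C}:X\to\mathbb{S}$ is continuous, and the names of $C$ are the names of $\chi_{X\setminus C}$ with respect to the canonical function space representation of the continuous functions $X\to\mathbb{S}$. Closed choice $C_X$ is the multi-valued function that maps a non-empty closed set $C\subseteq X$, given by such a name, to an arbitrary point of $C$. A multi-valued function $h$ on represented spaces is closed under composition if $f\leq_W h$ and $g\leq_W h$ imply $f\circ g\leq_W h$, for all multi-valued functions $g:\subseteq X\rightrightarrows Y$ and $f:\subseteq Y\rightrightarrows Z$ on represented spaces; $h$ is idempotent if $h\times h\leq_W h$ and $h\leq_W h\times h$. Theorem (Independent Choice).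 (1) Let $A,B\subseteq\mathbb{N}^{\mathbb{N}}$, let $X,Y,Z$ be represented spaces, and let $f:\subseteq Y\rightrightarrows Z$ and $g:\subseteq X\rightrightarrows Y$ be multi-valued functions. If $f\leq_W C_A$ and $g\leq_W C_B$, then $f\circ g\leq_W C_{A\times B}$. (2) Let $A\subseteq\mathbb{N}^{\mathbb{N}}$. If there is a computable surjection $s:A\to A\times A$, then $C_{A\times A}\leq_W C_A$, and $C_A$ is closed under composition and idempotent. (3) Each of $C_{\mathbb{N}}$, $C_{2^{\mathbb{N}}}$, $C_{\mathbb{N}^{\mathbb{N}}}$, $C_{\mathbb{N}\times 2^{\mathbb{N}}}$ and $C_{\mathbb{R}}$ is closed under composition and idempotent. -/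

import Mathlib

open Filter Topology

universe u v w

namespace Weihrauch

/-! ### Computable functions on Baire space `ℕ → ℕ` -/

/-- The partial recursive functionals `Φ : ℕ^ℕ × ℕ ⇀ ℕ` of Kleene, i.e. the functions computed by
oracle machines, uniformly in the oracle `p : ℕ → ℕ`: the least class that contains the basic
functions and the oracle and is closed under pairing, composition, primitive recursion and
unbounded search. -/
inductive RecursiveFunctional : ((ℕ → ℕ) → ℕ →. ℕ) → Prop
  | zero : RecursiveFunctional fun _ _ => Part.some 0
  | succ : RecursiveFunctional fun _ n => Part.some (n + 1)
  | left : RecursiveFunctional fun _ n => Part.some (Nat.unpair n).1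
  | right : RecursiveFunctional fun _ n => Part.some (Nat.unpair n).2
  | oracle : RecursiveFunctional fun p n => Part.some (p n)
  | pair {Φ Ψ : (ℕ → ℕ) → ℕ →. ℕ} (hΦ : RecursiveFunctional Φ) (hΨ : RecursiveFunctional Ψ) :
      RecursiveFunctional fun p n => Nat.pair <$> Φ p n <*> Ψ p n
  | comp {Φ Ψ : (ℕ → ℕ) → ℕ →. ℕ} (hΦ : RecursiveFunctional Φ) (hΨ : RecursiveFunctional Ψ) :
      RecursiveFunctional fun p n => Ψ p n >>= Φ p
  | prec {Φ Ψ : (ℕ → ℕ) → ℕ →. ℕ} (hΦ : RecursiveFunctional Φ) (hΨ : RecursiveFunctional Ψ) :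
      RecursiveFunctional fun p m =>
        let (a, n) := Nat.unpair m
        n.rec (Φ p a) fun y IH => do
          let i ← IH
          Ψ p (Nat.pair a (Nat.pair y i))
  | rfind {Φ : (ℕ → ℕ) → ℕ →. ℕ} (hΦ : RecursiveFunctional Φ) :
      RecursiveFunctional fun p a =>
        Nat.rfind fun n => (fun m => decide (m = 0)) <$> Φ p (Nat.pair a n)

/-- A partial function `F` on Baire space is computable if some oracle machine computes, for every
`p` in the domain of `F`, the sequence `F p` from the oracle `p`. -/
def ComputableOnBaire (F : (ℕ → ℕ) →. (ℕ → ℕ)) : Prop :=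
  ∃ Φ : (ℕ → ℕ) → ℕ →. ℕ, RecursiveFunctional Φ ∧
    ∀ p : ℕ → ℕ, ∀ q ∈ F p, ∀ n : ℕ, q n ∈ Φ p n

/-- The pairing `⟨p, q⟩ = (p 0, q 0, p 1, q 1, …)` on Baire space. -/
def pairing (p q : ℕ → ℕ) : ℕ → ℕ :=
  fun n => if n % 2 = 0 then p (n / 2) else q (n / 2)

theorem pairing_even (p q : ℕ → ℕ) (n : ℕ) : pairing p q (2 * n) = p n := by
  simp [pairing]

theorem pairing_odd (p q : ℕ → ℕ) (n : ℕ) : pairing p q (2 * n + 1) = q n := by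
  have h : (2 * n + 1) / 2 = n := by omega
  simp [pairing, Nat.add_mod, h]

theorem pairing_inj {p q p' q' : ℕ → ℕ} (h : pairing p q = pairing p' q') : p = p' ∧ q = q' := by
  constructor
  · funext n
    rw [← pairing_even p q n, h, pairing_even]
  · funext n
    rw [← pairing_odd p q n, h, pairing_odd]

/-- The unique element satisfying `P`, defined if there is exactly one. -/
noncomputable def theUnique {X : Type u} (P : X → Prop) : Part X :=
  ⟨∃! x, P x, fun h => h.choose⟩

theorem mem_theUnique {X : Type u} {P : X → Prop} (hP : ∀ x y, P x → P y → x = y) {a : X} :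
    a ∈ theUnique P ↔ P a := by
  constructor
  · rintro ⟨h, rfl⟩
    exact h.choose_spec.1
  · intro ha
    have h : ∃! x, P x := ⟨a, ha, fun y hy => hP y a hy ha⟩
    exact ⟨h, hP _ _ h.choose_spec.1 ha⟩

/-! ### Represented spaces, multi-valued functions and realizers -/

/-- A represented space: a set `X` with a partial surjective function `δ` from Baire space
onto `X`. If `x ∈ δ p`, then `p` is a name of `x`. -/
class RepresentedSpace (X : Type u) where
  δ : (ℕ → ℕ) →. X
  surj : ∀ x : X, ∃ p : ℕ → ℕ, x ∈ δ p

/-- The domain of a partial multi-valued function `f`, where `f x` is the set of values at `x`. -/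
def multiDom {X : Type u} {Y : Type v} (f : X → Set Y) : Set X :=
  {x | (f x).Nonempty}

/-- The composition `f ∘ g` of multi-valued functions:
`dom (f ∘ g) = {x ∈ dom g | g x ⊆ dom f}` and `(f ∘ g) x = ⋃_{y ∈ g x} f y` there. -/
def multiComp {X : Type u} {Y : Type v} {Z : Type w} (f : Y → Set Z) (g : X → Set Y) :
    X → Set Z :=
  fun x => {z | g x ⊆ multiDom f ∧ ∃ y ∈ g x, z ∈ f y}

/-- The product `f × g` of multi-valued functions. -/
def multiProd {X Y Z W : Type*} (f : X → Set Y) (g : Z → Set W) : X × Z → Set (Y × W) :=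
  fun a => f a.1 ×ˢ g a.2

/-- `F ⊢ f`: the partial function `F` on Baire space is a realizer of `f`. -/
def Realizes {X : Type u} {Y : Type v} [RepresentedSpace X] [RepresentedSpace Y]
    (F : (ℕ → ℕ) →. (ℕ → ℕ)) (f : X → Set Y) : Prop :=
  ∀ p : ℕ → ℕ, ∀ x ∈ RepresentedSpace.δ (X := X) p, x ∈ multiDom f →
    ∃ q ∈ F p, ∃ y ∈ RepresentedSpace.δ (X := Y) q, y ∈ f x

/-- A total single-valued function between represented spaces is computable if it has a
computable realizer. -/
def IsComputableMap {X : Type u} {Y : Type v} [RepresentedSpace X] [RepresentedSpace Y]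
    (f : X → Y) : Prop :=
  ∃ F : (ℕ → ℕ) →. (ℕ → ℕ), ComputableOnBaire F ∧ Realizes F (fun x => {f x})

/-- A total single-valued function between represented spaces is continuous (with respect to the
representations) if it has a continuous realizer. -/
def IsContinuousMap {X : Type u} {Y : Type v} [RepresentedSpace X] [RepresentedSpace Y]
    (f : X → Y) : Prop :=
  ∃ F : (ℕ → ℕ) →. (ℕ → ℕ), Continuous F.asSubtype ∧ Realizes F (fun x => {f x})

/-! ### Weihrauch reducibility -/

/-- Weihrauch reducibility `f ≤_W g`: there are computable `K` and `H` such that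
`K ∘ ⟨id, G ∘ H⟩` is a realizer of `f` for every realizer `G` of `g`. -/
def WeihrauchLE {X Y U V : Type*} [RepresentedSpace X] [RepresentedSpace Y]
    [RepresentedSpace U] [RepresentedSpace V] (f : X → Set Y) (g : U → Set V) : Prop :=
  ∃ K H : (ℕ → ℕ) →. (ℕ → ℕ), ComputableOnBaire K ∧ ComputableOnBaire H ∧
    ∀ G : (ℕ → ℕ) →. (ℕ → ℕ), Realizes G g →
      Realizes (fun p => (H p).bind fun r => (G r).bind fun s => K (pairing p s)) f

/-- `h` is closed under composition: `f ≤_W h` and `g ≤_W h` imply `f ∘ g ≤_W h`, for all `f` and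
`g` of composable types on represented spaces. -/
def ClosedUnderComposition {U V : Type*} [RepresentedSpace U] [RepresentedSpace V]
    (h : U → Set V) : Prop :=
  ∀ (X : Type u) (Y : Type v) (Z : Type w)
    [RepresentedSpace X] [RepresentedSpace Y] [RepresentedSpace Z]
    (f : Y → Set Z) (g : X → Set Y),
    WeihrauchLE f h → WeihrauchLE g h → WeihrauchLE (multiComp f g) h

/-! ### Basic represented spaces -/

/-- The product representation: `⟨p, q⟩` is a name of `(x, y)` if `p` is a name of `x` and
`q` is a name of `y`. -/
instance {X : Type u} {Y : Type v} [RepresentedSpace X] [RepresentedSpace Y] :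
    RepresentedSpace (X × Y) where
  δ r := (RepresentedSpace.δ (X := X) fun n => r (2 * n)).bind fun x =>
    (RepresentedSpace.δ (X := Y) fun n => r (2 * n + 1)).map fun y => (x, y)
  surj := by
    rintro ⟨x, y⟩
    obtain ⟨p, hp⟩ := RepresentedSpace.surj x
    obtain ⟨q, hq⟩ := RepresentedSpace.surj y
    refine ⟨pairing p q, ?_⟩
    simp only [pairing_even, pairing_odd]
    exact Part.mem_bind hp (Part.mem_map _ hq)

/-- The product `f × f` is Weihrauch equivalent to `f`. -/
def IsIdempotentDegree {U V : Type*} [RepresentedSpace U] [RepresentedSpace V]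
    (f : U → Set V) : Prop :=
  WeihrauchLE (multiProd f f) f ∧ WeihrauchLE f (multiProd f f)

/-- Baire space, represented by the identity. -/
instance : RepresentedSpace (ℕ → ℕ) where
  δ p := Part.some p
  surj p := ⟨p, Part.mem_some p⟩

/-- A subspace `A` of Baire space, represented by the restriction of the identity to `A`. -/
instance (A : Set (ℕ → ℕ)) : RepresentedSpace A where
  δ p := ⟨p ∈ A, fun h => ⟨p, h⟩⟩
  surj a := ⟨a, a.2, rfl⟩

/-- Cantor space `{0,1}^ℕ` as a subspace of Baire space. -/
def Cantor : Set (ℕ → ℕ) := {p | ∀ n, p n = 0 ∨ p n = 1}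

/-- The natural numbers, represented by `p ↦ p 0`. -/
instance : RepresentedSpace ℕ where
  δ p := Part.some (p 0)
  surj n := ⟨fun _ => n, Part.mem_some n⟩

/-- Sierpinski space `{0,1}`, as the type of truth values: `p` is a name of `1` (i.e. `True`) if
`p n = 0` for some `n`, and a name of `0` (i.e. `False`) otherwise. -/
instance : RepresentedSpace Prop where
  δ p := Part.some (∃ n, p n = 0)
  surj P := by
    by_cases h : P
    · exact ⟨fun _ => 0, by simp [h]⟩
    · exact ⟨fun _ => 1, by simp [h]⟩

/-- A standard numbering of the rational numbers: `⟨⟨i, j⟩, k⟩ ↦ (i - j) / (k + 1)`. -/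
def ratOfNat (n : ℕ) : ℚ :=
  (((Nat.unpair (Nat.unpair n).1).1 : ℚ) - ((Nat.unpair (Nat.unpair n).1).2 : ℚ)) /
    (((Nat.unpair n).2 : ℚ) + 1)

theorem ratOfNat_surjective (x : ℚ) : ∃ n, ratOfNat n = x := by
  refine ⟨Nat.pair (Nat.pair x.num.toNat (-x.num).toNat) (x.den - 1), ?_⟩
  have h1 : ((x.num.toNat : ℚ) - ((-x.num).toNat : ℚ)) = (x.num : ℚ) := by
    have h : ((x.num.toNat : ℤ) - ((-x.num).toNat : ℤ)) = x.num := by omega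
    exact_mod_cast h
  have h2 : (((x.den - 1 : ℕ) : ℚ) + 1) = (x.den : ℚ) := by
    have h : (x.den - 1) + 1 = x.den := Nat.sub_add_cancel x.pos
    exact_mod_cast h
  simp only [ratOfNat, Nat.unpair_pair, h1, h2]
  exact Rat.num_div_den x

/-- `p` is a Cauchy name of `x`: the sequence of rational numbers coded by `p` is rapidly
converging, with limit `x`. -/
def IsCauchyName (p : ℕ → ℕ) (x : ℝ) : Prop :=
  (∀ i j : ℕ, j < i → |(ratOfNat (p i) : ℝ) - (ratOfNat (p j) : ℝ)| < (1 / 2) ^ j) ∧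
    Tendsto (fun i => (ratOfNat (p i) : ℝ)) atTop (𝓝 x)

theorem exists_isCauchyName (x : ℝ) : ∃ p, IsCauchyName p x := by
  have h (i : ℕ) : ∃ n : ℕ, |(ratOfNat n : ℝ) - x| < (1 / 2) ^ (i + 1) := by
    obtain ⟨r, h1, h2⟩ := exists_rat_btwn
      (show x < x + (1 / 2) ^ (i + 1) from lt_add_of_pos_right x (by positivity))
    obtain ⟨n, rfl⟩ := ratOfNat_surjective r
    exact ⟨n, by rw [abs_lt]; constructor <;> linarith [show (0 : ℝ) < (1 / 2) ^ (i + 1) by positivity]⟩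
  choose p hp using h
  refine ⟨p, fun i j hij => ?_, ?_⟩
  · have h1 : (1 / 2 : ℝ) ^ (i + 1) ≤ (1 / 2) ^ (j + 1) :=
      pow_le_pow_of_le_one (by norm_num) (by norm_num) (by omega)
    have h2 : (1 / 2 : ℝ) ^ (j + 1) = (1 / 2) ^ j / 2 := by ring
    have h3 := abs_lt.1 (hp i)
    have h4 := abs_lt.1 (hp j)
    rw [abs_lt]
    constructor <;> linarith [h3.1, h3.2, h4.1, h4.2]
  · rw [tendsto_iff_dist_tendsto_zero]
    refine squeeze_zero (fun _ => dist_nonneg) (fun i => (hp i).le) ?_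
    exact (tendsto_pow_atTop_nhds_zero_of_lt_one (by norm_num) (by norm_num)).comp
      (tendsto_add_atTop_nat 1)

/-- The real numbers with the Cauchy representation. -/
noncomputable instance : RepresentedSpace ℝ where
  δ p := theUnique (IsCauchyName p)
  surj x := by
    obtain ⟨p, hp⟩ := exists_isCauchyName x
    exact ⟨p, (mem_theUnique fun _ _ ha hb => tendsto_nhds_unique ha.2 hb.2).2 hp⟩

theorem mem_δ_real {p : ℕ → ℕ} {x : ℝ} :
    x ∈ RepresentedSpace.δ (X := ℝ) p ↔ IsCauchyName p x :=
  mem_theUnique fun _ _ ha hb => tendsto_nhds_unique ha.2 hb.2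

/-! ### The function space representation -/

/-- The prefix `q 0, …, q (k - 1)` of `q`. -/
def prefixOf (q : ℕ → ℕ) (k : ℕ) : List ℕ := (List.range k).map q

/-- The standard coding of the continuous partial functions on Baire space (with natural domain) by
points `p` of Baire space: the `n`-th value of the function with code `p` at `q` is `m`, if
`p ⟨n, w⟩ = m + 1` for the shortest prefix `w` of `q` with `p ⟨n, w⟩ ≠ 0`. -/
def evalCode (p q : ℕ → ℕ) (n : ℕ) : Part ℕ :=
  Nat.rfindOpt fun k => Nat.ppred (p (Nat.pair n (Encodable.encode (prefixOf q k))))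

/-- The partial function on Baire space with code `p`, defined where all values exist. -/
def codedMap (p : ℕ → ℕ) : (ℕ → ℕ) →. (ℕ → ℕ) :=
  fun q => ⟨∀ n, (evalCode p q n).Dom, fun h n => (evalCode p q n).get (h n)⟩

theorem prefixOf_eq_iff {q r : ℕ → ℕ} {k : ℕ} : prefixOf q k = prefixOf r k ↔ ∀ i < k, q i = r i := by
  simp [prefixOf]

theorem prefixOf_length (q : ℕ → ℕ) (k : ℕ) : (prefixOf q k).length = k := by
  simp [prefixOf]

/-- Every continuous partial function on Baire space has an extension with a code. -/
theorem exists_codedMap {F : (ℕ → ℕ) →. (ℕ → ℕ)} (hF : Continuous F.asSubtype) :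
    ∃ p, ∀ q, ∀ r ∈ F q, r ∈ codedMap p q := by
  classical
  let P : ℕ → List ℕ → ℕ → Prop := fun n l v =>
    (∃ q r, r ∈ F q ∧ prefixOf q l.length = l) ∧
      ∀ q r, r ∈ F q → prefixOf q l.length = l → r n = v
  let c : ℕ → List ℕ → ℕ := fun n l => if h : ∃ v, P n l v then h.choose + 1 else 0
  let p : ℕ → ℕ := fun m =>
    match (Encodable.decode (Nat.unpair m).2 : Option (List ℕ)) with
    | some l => c (Nat.unpair m).1 l
    | none => 0
  have hp (n : ℕ) (l : List ℕ) : p (Nat.pair n (Encodable.encode l)) = c n l := by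
    simp [p]
  refine ⟨p, fun q r hr => ?_⟩
  have key (n : ℕ) : r n ∈ evalCode p q n := by
    have hval : ∀ k m, m ∈ Nat.ppred (p (Nat.pair n (Encodable.encode (prefixOf q k)))) →
        m = r n := by
      intro k m hm
      rw [hp] at hm
      by_cases h : ∃ v, P n (prefixOf q k) v
      · simp only [c, dif_pos h, Nat.ppred_succ, Option.mem_some_iff] at hm
        rw [← hm]
        exact (h.choose_spec.2 q r hr (by rw [prefixOf_length])).symm
      · simp [c, dif_neg h] at hm
    have hex : ∃ k, ∃ v, P n (prefixOf q k) v := by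
      obtain ⟨hd, rfl⟩ := hr
      have hc : Continuous fun z : F.Dom => F.asSubtype z n := (continuous_apply n).comp hF
      have ho : IsOpen {z : F.Dom | F.asSubtype z n = F.asSubtype ⟨q, hd⟩ n} :=
        (isOpen_discrete {F.asSubtype ⟨q, hd⟩ n}).preimage hc
      obtain ⟨U, hU, hUeq⟩ := isOpen_induced_iff.1 ho
      have hqU : q ∈ U := by
        have : (⟨q, hd⟩ : F.Dom) ∈ Subtype.val ⁻¹' U := by rw [hUeq]; rfl
        exact this
      obtain ⟨I, u, hu, hIU⟩ := isOpen_pi_iff.1 hU q hqU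
      refine ⟨I.sup id + 1, F.asSubtype ⟨q, hd⟩ n, ⟨q, _, ⟨hd, rfl⟩, by rw [prefixOf_length]⟩, ?_⟩
      rintro q' r' ⟨hd', rfl⟩ hq'
      rw [prefixOf_length, prefixOf_eq_iff] at hq'
      have hq'U : q' ∈ U := hIU fun i hi => by
        have : i ≤ I.sup id := Finset.le_sup (f := id) hi
        rw [hq' i (by omega)]
        exact (hu i hi).2
      have : (⟨q', hd'⟩ : F.Dom) ∈ {z : F.Dom | F.asSubtype z n = F.asSubtype ⟨q, hd⟩ n} := by
        rw [← hUeq]; exact hq'U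
      exact this
    obtain ⟨k, v, hv⟩ := hex
    have hdom : (evalCode p q n).Dom := by
      refine Nat.rfindOpt_dom.2 ⟨k, c n (prefixOf q k) - 1, ?_⟩
      rw [hp]
      simp [c, dif_pos (show ∃ v, P n (prefixOf q k) v from ⟨v, hv⟩)]
    obtain ⟨j, hj⟩ := Nat.rfindOpt_spec ⟨hdom, rfl⟩
    rw [← hval j _ hj]
    exact ⟨hdom, rfl⟩
  exact ⟨fun n => (key n).1, funext fun n => (key n).2⟩

/-- The space `C(X, Y)` of the continuous functions between represented spaces. -/
def ContinuousFun (X : Type u) (Y : Type v) [RepresentedSpace X] [RepresentedSpace Y] :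
    Type (max u v) :=
  {f : X → Y // IsContinuousMap f}

theorem realizes_unique {X : Type u} {Y : Type v} [RepresentedSpace X] [RepresentedSpace Y]
    {F : (ℕ → ℕ) →. (ℕ → ℕ)} {f g : X → Y} (hf : Realizes F (fun x => {f x}))
    (hg : Realizes F (fun x => {g x})) : f = g := by
  funext x
  obtain ⟨p, hp⟩ := RepresentedSpace.surj x
  obtain ⟨q, hq, y, hy, rfl⟩ := hf p x hp ⟨f x, rfl⟩
  obtain ⟨q', hq', y', hy', rfl⟩ := hg p x hp ⟨g x, rfl⟩
  obtain rfl := Part.mem_unique hq hq'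
  exact Part.mem_unique hy hy'

/-- The function space representation `[δ_X → δ_Y]`: `p` is a name of `f` if the function coded by
`p` is a realizer of `f`. -/
noncomputable instance {X : Type u} {Y : Type v} [RepresentedSpace X] [RepresentedSpace Y] :
    RepresentedSpace (ContinuousFun X Y) where
  δ p := theUnique fun f => Realizes (codedMap p) (fun x => {f.1 x})
  surj := by
    rintro ⟨f, F, hF, hf⟩
    obtain ⟨p, hp⟩ := exists_codedMap hF
    refine ⟨p, (mem_theUnique fun _ _ h h' => Subtype.ext (realizes_unique h h')).2 ?_⟩
    intro q x hx hd
    obtain ⟨r, hr, y, hy⟩ := hf q x hx hd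
    exact ⟨r, hp q r hr, y, hy⟩

theorem mem_δ_continuousFun {X : Type u} {Y : Type v} [RepresentedSpace X] [RepresentedSpace Y]
    {p : ℕ → ℕ} {f : ContinuousFun X Y} :
    f ∈ RepresentedSpace.δ p ↔ Realizes (codedMap p) (fun x => {f.1 x}) :=
  mem_theUnique fun _ _ h h' => Subtype.ext (realizes_unique h h')

/-! ### Closed sets and closed choice -/

/-- The closed subsets of a represented space: those sets, for which the characteristic function
of the complement, with values in Sierpinski space, is continuous. -/
def ClosedSet (X : Type u) [RepresentedSpace X] : Type u :=
  {C : Set X // IsContinuousMap fun x => x ∉ C}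

/-- The closed set with a given (continuous) characteristic function of the complement. -/
def ClosedSet.ofCompl {X : Type u} [RepresentedSpace X] (U : ContinuousFun X Prop) :
    ClosedSet X :=
  ⟨{x | ¬ U.1 x}, by simpa using U.2⟩

/-- The negative information representation `ψ_-` of the closed subsets of `X`: the names of `C`
are the `[δ_X → δ_𝕊]`-names of the characteristic function of `X \ C`. -/
noncomputable instance {X : Type u} [RepresentedSpace X] : RepresentedSpace (ClosedSet X) where
  δ p := (RepresentedSpace.δ (X := ContinuousFun X Prop) p).map ClosedSet.ofCompl
  surj C := by
    obtain ⟨p, hp⟩ :=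
      RepresentedSpace.surj (X := ContinuousFun X Prop) ⟨fun x => x ∉ C.1, C.2⟩
    refine ⟨p, (Part.mem_map_iff _).2 ⟨_, hp, Subtype.ext ?_⟩⟩
    ext x
    simp [ClosedSet.ofCompl]

theorem mem_δ_closedSet {X : Type u} [RepresentedSpace X] {p : ℕ → ℕ} {C : ClosedSet X} :
    C ∈ RepresentedSpace.δ p ↔ Realizes (codedMap p) (fun x => {x ∉ C.1}) := by
  refine (Part.mem_map_iff _).trans ⟨?_, fun h => ?_⟩
  · rintro ⟨U, hU, rfl⟩
    simpa [ClosedSet.ofCompl] using mem_δ_continuousFun.1 hU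
  · refine ⟨⟨fun x => x ∉ C.1, C.2⟩, mem_δ_continuousFun.2 h, Subtype.ext ?_⟩
    ext x
    simp [ClosedSet.ofCompl]

/-- Closed choice `C_X`, the multi-valued function that maps a non-empty closed set `C`, given by
negative information, to all its points; its domain consists of the non-empty closed sets. -/
def closedChoice (X : Type u) [RepresentedSpace X] : ClosedSet X → Set X :=
  fun C => C.1

end Weihrauch

open Weihrauch

namespace Weihrauch

/-! Closed choice on `V` is nondeterministic computation with advice from `V`: `f ≤_W C_V` holds iff
a machine that reads a name `p` of an input and a guessed name of a point of `V` recognises wrong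
guesses in finite time, some guess is right, and a solution is computed from every right one
(`weihrauchLE_closedChoice_iff`). This rests on two facts about oracle machines: evaluation of coded
functions is computable (`recursiveFunctional_evalCode`), and the sections of a semidecidable set
have computable codes (`SemiDec.exists_code`). The second comes from approximating machines by
primitive recursive functions of finite oracle prefixes (`RecursiveFunctional.exists_approximates`).

For `f ∘ g`, guess `a` and `b` at once: `b` serves `g` and yields a name `t` of some value, and `a`
serves `f` on the input `t`. A pair is wrong if `b` is wrong or if `a` is wrong for `t`, and both
are recognisable. Points of `A` and `B` have exactly one name, so `t` depends only on the point `b`,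
and the right pairs form a well-defined set. This is where subspaces of Baire space are needed
(`multiComp_le_closedChoice_prod`).

Closed sets pull back along computable surjections (`closedChoice_le_of_surjective`), so a
surjection of `A` onto `A × A` gives `C_{A×A} ≤_W C_A`, hence closure under composition; idempotency
follows with `C_X × C_Y ≤_W C_{X×Y}`. Each concrete space has the same closed choice degree as some
`D^ℕ` or `ℕ × D^ℕ` inside Baire space, and these map onto their squares. Only the reals need real
work: signed binary expansions map `ℕ × 2^ℕ` onto them, and base 4 expansions with digits 0 and 1
embed `ℕ × 2^ℕ` with computable inverse and co-semidecidable range (`closedChoice_le_of_embedding`).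
-/

/-! ### Recursive functionals -/

/-- A functional with values in `β` and arguments in `α`, total and computable uniformly in the
oracle. -/
def TotalRecursive {α β : Type*} [Primcodable α] [Primcodable β]
    (g : (ℕ → ℕ) → α → β) : Prop :=
  ∃ g' : (ℕ → ℕ) → ℕ → ℕ, (RecursiveFunctional fun p n => Part.some (g' p n)) ∧
    ∀ p a, g' p (Encodable.encode a) = Encodable.encode (g p a)

theorem RecursiveFunctional.of_eq {Φ Ψ : (ℕ → ℕ) → ℕ →. ℕ} (hΦ : RecursiveFunctional Φ)
    (h : ∀ p n, Φ p n = Ψ p n) : RecursiveFunctional Ψ :=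
  (funext fun p => funext (h p) : Φ = Ψ) ▸ hΦ

theorem RecursiveFunctional.of_partrec {f : ℕ →. ℕ} (hf : Nat.Partrec f) :
    RecursiveFunctional fun _ => f := by
  induction hf with
  | zero => exact .zero
  | succ => exact .succ
  | left => exact .left
  | right => exact .right
  | pair _ _ h1 h2 => exact .pair h1 h2
  | comp _ _ h1 h2 => exact .comp h1 h2
  | prec _ _ h1 h2 => exact .prec h1 h2
  | rfind _ h => exact .rfind h

theorem RecursiveFunctional.of_primrec {f : ℕ → ℕ} (hf : Nat.Primrec f) :
    RecursiveFunctional fun _ n => Part.some (f n) :=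
  of_partrec (Nat.Partrec.of_primrec hf)

theorem RecursiveFunctional.comp_total {Φ : (ℕ → ℕ) → ℕ →. ℕ} {g : (ℕ → ℕ) → ℕ → ℕ}
    (hΦ : RecursiveFunctional Φ) (hg : RecursiveFunctional fun p n => Part.some (g p n)) :
    RecursiveFunctional fun p n => Φ p (g p n) :=
  (RecursiveFunctional.comp hΦ hg).of_eq fun p n => Part.bind_some (g p n) (Φ p)

namespace TotalRecursive

variable {α β γ : Type*} [Primcodable α] [Primcodable β] [Primcodable γ]

theorem nat_iff {g : (ℕ → ℕ) → ℕ → ℕ} :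
    TotalRecursive g ↔ RecursiveFunctional fun p n => Part.some (g p n) := by
  constructor
  · rintro ⟨g', h, hg⟩
    have : g' = g := by
      funext p n
      simpa using hg p n
    exact this ▸ h
  · exact fun h => ⟨g, h, fun p n => by simp⟩

theorem of_primrec {f : α → β} (hf : Primrec f) : TotalRecursive fun _ a => f a := by
  -- `Primrec f` speaks of `encode ((decode n).map f)`, in which `some` shifts codes by one; the
  -- predecessor undoes the shift.
  refine ⟨_, RecursiveFunctional.of_primrec (Nat.Primrec.pred.comp hf), fun p a => ?_⟩
  simp

theorem comp {f : (ℕ → ℕ) → β → γ} {g : (ℕ → ℕ) → α → β}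
    (hf : TotalRecursive f) (hg : TotalRecursive g) : TotalRecursive fun p a => f p (g p a) := by
  obtain ⟨f', hf, hf'⟩ := hf
  obtain ⟨g', hg, hg'⟩ := hg
  exact ⟨_, hf.comp_total hg, fun p a => by rw [hg', hf']⟩

theorem pair {f : (ℕ → ℕ) → α → β} {g : (ℕ → ℕ) → α → γ}
    (hf : TotalRecursive f) (hg : TotalRecursive g) :
    TotalRecursive fun p a => (f p a, g p a) := by
  obtain ⟨f', hf, hf'⟩ := hf
  obtain ⟨g', hg, hg'⟩ := hg
  refine ⟨fun p n => Nat.pair (f' p n) (g' p n), ?_, fun p a => ?_⟩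
  · exact (RecursiveFunctional.pair hf hg).of_eq fun p n => by simp [Seq.seq]
  · exact congrArg₂ Nat.pair (hf' p a) (hg' p a)

theorem primrec_comp {f : β → γ} {g : (ℕ → ℕ) → α → β} (hf : Primrec f)
    (hg : TotalRecursive g) : TotalRecursive fun p a => f (g p a) :=
  (of_primrec hf).comp hg

theorem primrec₂_comp {δ : Type*} [Primcodable δ] {f : β → γ → δ} {g : (ℕ → ℕ) → α → β}
    {h : (ℕ → ℕ) → α → γ} (hf : Primrec₂ f) (hg : TotalRecursive g) (hh : TotalRecursive h) :
    TotalRecursive fun p a => f (g p a) (h p a) :=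
  (of_primrec hf).comp (hg.pair hh)

theorem oracle : TotalRecursive fun p n => p n :=
  nat_iff.2 .oracle

theorem oracle_comp {g : (ℕ → ℕ) → α → ℕ} (hg : TotalRecursive g) :
    TotalRecursive fun p a => p (g p a) :=
  oracle.comp hg

theorem arg : TotalRecursive fun _ (a : α) => a :=
  of_primrec .id

theorem nat_rec {f : (ℕ → ℕ) → ℕ} {g : (ℕ → ℕ) → ℕ × ℕ → ℕ}
    (hf : TotalRecursive fun p (_ : ℕ) => f p) (hg : TotalRecursive g) :
    TotalRecursive fun p n => (Nat.rec (f p) (fun y i => g p (y, i)) n : ℕ) := by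
  obtain ⟨g', hg, hg'⟩ := hg
  rw [nat_iff] at hf ⊢
  -- The recursion scheme carries a parameter: the step discards it by `right`, and it is set to `0`
  -- afterwards.
  have h := RecursiveFunctional.prec hf
    (hg.comp_total (RecursiveFunctional.of_primrec Nat.Primrec.right))
  have h2 := h.comp_total (RecursiveFunctional.of_primrec
    ((Nat.Primrec.const 0).pair Nat.Primrec.id))
  refine (congrArg RecursiveFunctional ?_).mpr h2
  funext p n
  simp only [Nat.unpair_pair]
  induction n with
  | zero => rfl
  | succ n ih =>
    simp only [id] at ih ⊢
    rw [← ih]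
    have := hg' p (n, Nat.rec (f p) (fun y i => g p (y, i)) n)
    simp only [Encodable.encode_nat] at this
    simp [← this]

theorem prefixOf {h : (ℕ → ℕ) → ℕ → ℕ} (hh : TotalRecursive h) :
    TotalRecursive fun p k => prefixOf (h p) k := by
  have hrec := nat_rec (f := fun _ => Encodable.encode ([] : List ℕ))
    (g := fun p yi => Encodable.encode
      (((Encodable.decode yi.2 : Option (List ℕ)).getD []) ++ [h p yi.1]))
    (of_primrec (Primrec.const _))
    (primrec_comp Primrec.encode
      (primrec₂_comp Primrec.list_append
        (of_primrec (Primrec.option_getD.comp (Primrec.decode.comp Primrec.snd)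
          (Primrec.const [])))
        (primrec₂_comp Primrec.list_cons (hh.comp (of_primrec Primrec.fst))
          (of_primrec (Primrec.const [])))))
  obtain ⟨g', hg, hg'⟩ := hrec
  refine ⟨g', hg, fun p k => ?_⟩
  rw [hg', Encodable.encode_nat]
  induction k with
  | zero => rfl
  | succ k ih =>
    simp only at ih ⊢
    rw [ih]
    simp [Weihrauch.prefixOf, List.range_succ]

end TotalRecursive

/-- Unbounded search for the first `k` with `g p (n, k) ≠ 0`. -/
theorem RecursiveFunctional.rfindOpt {g : (ℕ → ℕ) → ℕ × ℕ → ℕ} (hg : TotalRecursive g) :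
    RecursiveFunctional fun p n => Nat.rfindOpt fun k => Nat.ppred (g p (n, k)) := by
  obtain ⟨g', hg, hg'⟩ := hg
  have hg' : ∀ p n k, g' p (Nat.pair n k) = g p (n, k) := fun p n k => hg' p (n, k)
  -- `rfind` looks for a zero; `1 - m` is zero exactly for `m ≠ 0`.
  have hsel : Nat.Primrec fun m : ℕ => 1 - m :=
    Primrec.nat_iff.1 (Primrec.nat_sub.comp (Primrec.const 1) Primrec.id)
  have h1 := RecursiveFunctional.rfind ((RecursiveFunctional.of_primrec hsel).comp_total hg)
  have h2 := (RecursiveFunctional.of_primrec Nat.Primrec.pred).comp_total hg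
  refine (RecursiveFunctional.comp h2 (RecursiveFunctional.pair
    (RecursiveFunctional.of_primrec Nat.Primrec.id) h1)).of_eq fun p n => ?_
  have hr : (Nat.rfind fun k => (fun m => decide (m = 0)) <$> Part.some (1 - g' p (Nat.pair n k))) =
      Nat.rfind fun k => ((Nat.ppred (g p (n, k))).isSome : Part Bool) := by
    congr 1
    funext k
    rw [hg']
    cases g p (n, k) <;> simp
  simp only [id, hr]
  ext m
  refine Part.mem_bind_iff.trans (Iff.trans ?_ Part.mem_bind_iff.symm)
  simp only [Seq.seq, Part.map_eq_map, Part.map_some, Part.bind_some, Part.mem_map_iff]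
  constructor
  · rintro ⟨_, ⟨k, hk, rfl⟩, hm⟩
    refine ⟨k, hk, ?_⟩
    have h := (Nat.mem_rfind.1 hk).1
    rw [hg'] at hm
    revert hm h
    cases g p (n, k) <;> simp [eq_comm]
  · rintro ⟨k, hk, hm⟩
    refine ⟨_, ⟨k, hk, rfl⟩, ?_⟩
    rw [hg']
    revert hm
    cases g p (n, k) <;> simp

/-- The universal machine: code and argument are interleaved in one oracle. -/
theorem recursiveFunctional_evalCode : RecursiveFunctional fun r n =>
    evalCode (fun i => r (2 * i)) (fun i => r (2 * i + 1)) n := by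
  refine RecursiveFunctional.rfindOpt (g := fun r nk => r (2 * Nat.pair nk.1
    (Encodable.encode (prefixOf (fun i => r (2 * i + 1)) nk.2)))) ?_
  refine .oracle_comp (.primrec_comp Primrec.nat_double (.primrec₂_comp Primrec₂.natPair
    (.of_primrec Primrec.fst) (.primrec_comp Primrec.encode (.comp (.prefixOf ?_)
      (.of_primrec Primrec.snd)))))
  exact .oracle_comp (.of_primrec Primrec.nat_double_succ)

/-- The sequence `q` is computed by the functional `Φ` from the oracle `p`. -/
def Computes (Φ : (ℕ → ℕ) → ℕ →. ℕ) (p q : ℕ → ℕ) : Prop :=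
  ∀ n, q n ∈ Φ p n

/-- Substitution of a functional for the oracle. -/
theorem RecursiveFunctional.subst {Φ Ψ : (ℕ → ℕ) → ℕ →. ℕ} (hΨ : RecursiveFunctional Ψ)
    (hΦ : RecursiveFunctional Φ) :
    ∃ Θ, RecursiveFunctional Θ ∧ ∀ p r, Computes Φ p r → Θ p = Ψ r := by
  induction hΨ with
  | zero => exact ⟨_, .zero, fun _ _ _ => rfl⟩
  | succ => exact ⟨_, .succ, fun _ _ _ => rfl⟩
  | left => exact ⟨_, .left, fun _ _ _ => rfl⟩
  | right => exact ⟨_, .right, fun _ _ _ => rfl⟩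
  | oracle => exact ⟨_, hΦ, fun p r h => funext fun n => Part.eq_some_iff.2 (h n)⟩
  | pair _ _ h1 h2 =>
    obtain ⟨Θ1, h1, e1⟩ := h1
    obtain ⟨Θ2, h2, e2⟩ := h2
    exact ⟨_, .pair h1 h2, fun p r h => by simp only [e1 p r h, e2 p r h]; rfl⟩
  | comp _ _ h1 h2 =>
    obtain ⟨Θ1, h1, e1⟩ := h1
    obtain ⟨Θ2, h2, e2⟩ := h2
    exact ⟨_, .comp h1 h2, fun p r h => by simp only [e1 p r h, e2 p r h]; rfl⟩
  | prec _ _ h1 h2 =>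
    obtain ⟨Θ1, h1, e1⟩ := h1
    obtain ⟨Θ2, h2, e2⟩ := h2
    exact ⟨_, .prec h1 h2, fun p r h => by simp only [e1 p r h, e2 p r h]; rfl⟩
  | rfind _ h1 =>
    obtain ⟨Θ1, h1, e1⟩ := h1
    exact ⟨_, .rfind h1, fun p r h => by simp only [e1 p r h]; rfl⟩

/-! ### Finite approximations -/

/-- `φ` approximates the functional `Φ` by finite prefixes of the oracle. -/
structure Approximates (φ : List ℕ → ℕ → Option ℕ) (Φ : (ℕ → ℕ) → ℕ →. ℕ) : Prop where
  primrec : Primrec₂ φ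
  mono : ∀ p n m k k', k ≤ k' → φ (prefixOf p k) n = some m → φ (prefixOf p k') n = some m
  mem_iff : ∀ p n m, m ∈ Φ p n ↔ ∃ k, φ (prefixOf p k) n = some m

/-- The case `n = L` is included because an unsuccessful `findIdx` returns the length. -/
theorem findIdx_range_eq {P : ℕ → Bool} {L n : ℕ} (hL : n ≤ L) (h : ∀ m < n, P m = false)
    (hn : P n = true) : (List.range L).findIdx P = n := by
  rcases hL.lt_or_eq with hL | rfl
  · rw [List.findIdx_eq (by simpa using hL)]
    simpa [hn] using h
  · rw [List.findIdx_eq_length_of_false]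
    · simp
    · simpa using h

namespace Approximates

theorem of_primrec {f : ℕ → ℕ} (hf : Primrec f) :
    Approximates (fun _ n => some (f n)) (fun _ n => Part.some (f n)) where
  primrec := Primrec.option_some.comp₂ (hf.comp₂ Primrec₂.right)
  mono := by simp
  mem_iff := by simp [eq_comm]

theorem oracle : Approximates (fun l n => l[n]?) (fun p n => Part.some (p n)) where
  primrec := Primrec.list_getElem?
  mono p n m k k' hk := by
    simp only [prefixOf, List.getElem?_map, Option.map_eq_some_iff, List.getElem?_eq_some_iff]
    rintro ⟨a, ⟨h, rfl⟩, rfl⟩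
    simp only [List.length_range, List.getElem_range] at h ⊢
    exact ⟨n, ⟨by omega, rfl⟩, rfl⟩
  mem_iff p n m := by
    simp only [prefixOf, List.getElem?_map, Option.map_eq_some_iff, List.getElem?_eq_some_iff,
      Part.mem_some_iff]
    constructor
    · rintro rfl
      exact ⟨n + 1, n, by simp, rfl⟩
    · rintro ⟨k, a, ⟨h, rfl⟩, rfl⟩
      simp

variable {φ ψ : List ℕ → ℕ → Option ℕ} {Φ Ψ : (ℕ → ℕ) → ℕ →. ℕ}

theorem pair (hφ : Approximates φ Φ) (hψ : Approximates ψ Ψ) :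
    Approximates (fun l n => (φ l n).bind fun a => (ψ l n).map (Nat.pair a))
      (fun p n => Nat.pair <$> Φ p n <*> Ψ p n) where
  primrec := Primrec.option_bind hφ.primrec (Primrec.option_map
    (hψ.primrec.comp (Primrec.fst.comp Primrec.fst) (Primrec.snd.comp Primrec.fst))
    (Primrec₂.natPair.comp (Primrec.snd.comp Primrec.fst) Primrec.snd))
  mono p n m k k' hk := by
    simp only [Option.bind_eq_some_iff, Option.map_eq_some_iff]
    rintro ⟨a, ha, b, hb, rfl⟩
    exact ⟨a, hφ.mono _ _ _ _ _ hk ha, b, hψ.mono _ _ _ _ _ hk hb, rfl⟩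
  mem_iff p n m := by
    simp only [Option.bind_eq_some_iff, Option.map_eq_some_iff, Seq.seq, Part.mem_bind_iff,
      Part.map_eq_map, Part.mem_map_iff]
    constructor
    · rintro ⟨_, ⟨a, ha, rfl⟩, b, hb, rfl⟩
      obtain ⟨k1, h1⟩ := (hφ.mem_iff _ _ _).1 ha
      obtain ⟨k2, h2⟩ := (hψ.mem_iff _ _ _).1 hb
      exact ⟨max k1 k2, a, hφ.mono _ _ _ _ _ (le_max_left _ _) h1, b,
        hψ.mono _ _ _ _ _ (le_max_right _ _) h2, rfl⟩
    · rintro ⟨k, a, ha, b, hb, rfl⟩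
      exact ⟨_, ⟨a, (hφ.mem_iff _ _ _).2 ⟨k, ha⟩, rfl⟩, b, (hψ.mem_iff _ _ _).2 ⟨k, hb⟩, rfl⟩

theorem comp (hφ : Approximates φ Φ) (hψ : Approximates ψ Ψ) :
    Approximates (fun l n => (ψ l n).bind (φ l)) (fun p n => Ψ p n >>= Φ p) where
  primrec := Primrec.option_bind hψ.primrec
    (hφ.primrec.comp (Primrec.fst.comp Primrec.fst) Primrec.snd)
  mono p n m k k' hk := by
    simp only [Option.bind_eq_some_iff]
    rintro ⟨a, ha, hb⟩
    exact ⟨a, hψ.mono _ _ _ _ _ hk ha, hφ.mono _ _ _ _ _ hk hb⟩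
  mem_iff p n m := by
    refine Part.mem_bind_iff.trans ?_
    simp only [Option.bind_eq_some_iff]
    constructor
    · rintro ⟨a, ha, hb⟩
      obtain ⟨k1, h1⟩ := (hψ.mem_iff _ _ _).1 ha
      obtain ⟨k2, h2⟩ := (hφ.mem_iff _ _ _).1 hb
      exact ⟨max k1 k2, a, hψ.mono _ _ _ _ _ (le_max_left _ _) h1,
        hφ.mono _ _ _ _ _ (le_max_right _ _) h2⟩
    · rintro ⟨k, a, ha, hb⟩
      exact ⟨a, (hψ.mem_iff _ _ _).2 ⟨k, ha⟩, (hφ.mem_iff _ _ _).2 ⟨k, hb⟩⟩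

theorem prec_mono (hφ : Approximates φ Φ) (hψ : Approximates ψ Ψ) {p : ℕ → ℕ} {a n m k k' : ℕ}
    (hk : k ≤ k') :
    (Nat.rec (φ (prefixOf p k) a) (fun y (IH : Option ℕ) => IH.bind fun i =>
      ψ (prefixOf p k) (Nat.pair a (Nat.pair y i))) n : Option ℕ) = some m →
    (Nat.rec (φ (prefixOf p k') a) (fun y (IH : Option ℕ) => IH.bind fun i =>
      ψ (prefixOf p k') (Nat.pair a (Nat.pair y i))) n : Option ℕ) = some m := by
  induction n generalizing m with
  | zero => exact hφ.mono _ _ _ _ _ hk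
  | succ n ih =>
    simp only [Option.bind_eq_some_iff]
    rintro ⟨i, hi, h⟩
    exact ⟨i, ih hi, hψ.mono _ _ _ _ _ hk h⟩

theorem prec (hφ : Approximates φ Φ) (hψ : Approximates ψ Ψ) :
    Approximates
      (fun l m => (Nat.rec (φ l m.unpair.1) (fun y (IH : Option ℕ) => IH.bind fun i =>
        ψ l (Nat.pair m.unpair.1 (Nat.pair y i))) m.unpair.2 : Option ℕ))
      (fun p m =>
        let (a, n) := Nat.unpair m
        n.rec (Φ p a) fun y IH => do
          let i ← IH
          Ψ p (Nat.pair a (Nat.pair y i))) where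
  primrec := by
    have hu : Primrec fun x : List ℕ × ℕ => x.2.unpair := Primrec.unpair.comp Primrec.snd
    refine Primrec.nat_rec' (h := fun x (yi : ℕ × Option ℕ) => yi.2.bind fun i =>
        ψ x.1 (Nat.pair x.2.unpair.1 (Nat.pair yi.1 i))) (Primrec.snd.comp hu)
      (hφ.primrec.comp Primrec.fst (Primrec.fst.comp hu)) ?_
    refine Primrec.option_bind (Primrec.snd.comp Primrec.snd) ?_
    refine hψ.primrec.comp (Primrec.fst.comp (Primrec.fst.comp Primrec.fst))
      (Primrec₂.natPair.comp (Primrec.fst.comp (hu.comp (Primrec.fst.comp Primrec.fst)))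
        (Primrec₂.natPair.comp (Primrec.fst.comp (Primrec.snd.comp Primrec.fst)) Primrec.snd))
  mono p n m k k' hk := hφ.prec_mono hψ hk
  mem_iff p n m := by
    simp only
    generalize n.unpair.1 = a
    generalize n.unpair.2 = n
    induction n generalizing m with
    | zero => exact hφ.mem_iff _ _ _
    | succ n ih =>
      simp only [Option.bind_eq_some_iff, Part.bind_eq_bind, Part.mem_bind_iff]
      constructor
      · rintro ⟨i, hi, h⟩
        obtain ⟨k1, h1⟩ := (ih _).1 hi
        obtain ⟨k2, h2⟩ := (hψ.mem_iff _ _ _).1 h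
        exact ⟨max k1 k2, i, hφ.prec_mono hψ (le_max_left _ _) h1,
          hψ.mono _ _ _ _ _ (le_max_right _ _) h2⟩
      · rintro ⟨k, i, hi, h⟩
        exact ⟨i, (ih _).2 ⟨k, hi⟩, (hψ.mem_iff _ _ _).2 ⟨k, h⟩⟩

/-- The bounded search that approximates unbounded search. -/
def search (φ : List ℕ → ℕ → Option ℕ) (l : List ℕ) (a : ℕ) : ℕ :=
  (List.range l.length).findIdx fun n => ((φ l (Nat.pair a n)).getD 0 == 0)

/-- An undefined value counts as `0` in `search`, so the search halts there instead of skipping it.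
This matches `rfind`, which demands that all earlier values be defined and nonzero. -/
theorem search_eq_iff {l : List ℕ} {a n : ℕ} (hn : n ≤ l.length)
    (h0 : φ l (Nat.pair a n) = some 0) :
    search φ l a = n ↔ ∀ j < n, ∃ v, φ l (Nat.pair a j) = some (v + 1) := by
  constructor
  · rintro rfl j hj
    have := List.not_of_lt_findIdx hj
    simp only [List.getElem_range] at this
    revert this
    rcases φ l (Nat.pair a j) with _ | _ | v <;> simp
  · intro h
    refine findIdx_range_eq hn (fun m hm => ?_) (by simp [h0])
    obtain ⟨v, hv⟩ := h m hm
    simp [hv]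

theorem search_le (l : List ℕ) (a : ℕ) : search φ l a ≤ l.length := by
  simpa [search] using List.findIdx_le_length (xs := List.range l.length)
    (p := fun n => ((φ l (Nat.pair a n)).getD 0 == 0))

/-- The candidate is accepted only if its value is known to be `0`, not merely unknown; hence longer
prefixes never revise an answer. The prefix length also bounds the search. -/
theorem rfind (hφ : Approximates φ Φ) :
    Approximates
      (fun l a => if φ l (Nat.pair a (search φ l a)) = some 0 then some (search φ l a) else none)
      (fun p a => Nat.rfind fun n => (fun m => decide (m = 0)) <$> Φ p (Nat.pair a n)) := by
  have key : ∀ l a n, (if φ l (Nat.pair a (search φ l a)) = some 0 then some (search φ l a)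
      else none) = some n ↔ n ≤ l.length ∧ φ l (Nat.pair a n) = some 0 ∧
        ∀ j < n, ∃ v, φ l (Nat.pair a j) = some (v + 1) := by
    intro l a n
    constructor
    · intro h
      split_ifs at h with h0
      obtain rfl := Option.some.inj h
      exact ⟨search_le _ _, h0, (search_eq_iff (search_le _ _) h0).1 rfl⟩
    · rintro ⟨hn, h0, h⟩
      have := (search_eq_iff hn h0).2 h
      rw [this, if_pos h0]
  refine ⟨?_, fun p a n k k' hk => ?_, fun p a n => ?_⟩
  · have hs : Primrec₂ (search φ) := by
      refine Primrec.list_findIdx (Primrec.list_range.comp (Primrec.list_length.comp Primrec.fst)) ?_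
      refine Primrec.beq.comp (Primrec.option_getD.comp (hφ.primrec.comp
        (Primrec.fst.comp Primrec.fst)
        (Primrec₂.natPair.comp (Primrec.snd.comp Primrec.fst) Primrec.snd)) (Primrec.const 0))
        (Primrec.const 0)
    exact Primrec.ite (Primrec.eq.comp (hφ.primrec.comp Primrec.fst
      (Primrec₂.natPair.comp Primrec.snd hs)) (Primrec.const _))
      (Primrec.option_some.comp hs) (Primrec.const _)
  · rw [key, key]
    rintro ⟨hn, h0, h⟩
    rw [prefixOf_length] at hn ⊢
    exact ⟨hn.trans hk, hφ.mono _ _ _ _ _ hk h0,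
      fun j hj => (h j hj).imp fun v hv => hφ.mono _ _ _ _ _ hk hv⟩
  · simp only [key, prefixOf_length]
    have hb : ∀ (b : Bool) (x : Part ℕ), b ∈ (fun m => decide (m = 0)) <$> x ↔
        ∃ m ∈ x, decide (m = 0) = b := fun b x => Part.mem_map_iff _
    refine Nat.mem_rfind.trans ?_
    simp only [hb, decide_eq_true_eq, decide_eq_false_iff_not]
    constructor
    · rintro ⟨⟨_, h0, rfl⟩, h⟩
      obtain ⟨k0, hk0⟩ := (hφ.mem_iff _ _ _).1 h0
      have h' : ∀ j, ∃ k, j < n → ∃ v, φ (prefixOf p k) (Nat.pair a j) = some (v + 1) := by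
        intro j
        by_cases hj : j < n
        · obtain ⟨v, hv, hv0⟩ := h hj
          obtain ⟨k, hk⟩ := (hφ.mem_iff _ _ _).1 hv
          exact ⟨k, fun _ => ⟨v - 1, by rw [hk]; congr; omega⟩⟩
        · exact ⟨0, fun h => absurd h hj⟩
      choose K hK using h'
      -- The prefix must be long enough for `n` to be within the search bound, for the zero at `n`,
      -- and for every nonzero value before it.
      refine ⟨n + k0 + (Finset.range n).sup K, by omega,
        hφ.mono _ _ _ _ _ (by omega) hk0, fun j hj => (hK j hj).imp fun v hv =>
          hφ.mono _ _ _ _ _ ?_ hv⟩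
      have := Finset.le_sup (f := K) (Finset.mem_range.2 hj)
      omega
    · rintro ⟨k, -, h0, h⟩
      refine ⟨⟨0, (hφ.mem_iff _ _ _).2 ⟨k, h0⟩, rfl⟩, fun {j} hj => ?_⟩
      obtain ⟨v, hv⟩ := h j hj
      exact ⟨v + 1, (hφ.mem_iff _ _ _).2 ⟨k, hv⟩, by omega⟩

end Approximates

/-- A terminating oracle computation reads finitely many oracle values, so a long enough prefix
suffices, both as oracle and as bound on all searches. -/
theorem RecursiveFunctional.exists_approximates {Φ : (ℕ → ℕ) → ℕ →. ℕ}
    (hΦ : RecursiveFunctional Φ) : ∃ φ, Approximates φ Φ := by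
  induction hΦ with
  | zero => exact ⟨_, .of_primrec (Primrec.const 0)⟩
  | succ => exact ⟨_, .of_primrec Primrec.succ⟩
  | left => exact ⟨_, .of_primrec (Primrec.fst.comp Primrec.unpair)⟩
  | right => exact ⟨_, .of_primrec (Primrec.snd.comp Primrec.unpair)⟩
  | oracle => exact ⟨_, .oracle⟩
  | pair _ _ h1 h2 => exact ⟨_, h1.choose_spec.pair h2.choose_spec⟩
  | comp _ _ h1 h2 => exact ⟨_, h1.choose_spec.comp h2.choose_spec⟩
  | prec _ _ h1 h2 => exact ⟨_, h1.choose_spec.prec h2.choose_spec⟩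
  | rfind _ h => exact ⟨_, h.choose_spec.rfind⟩

/-! ### Semidecidable sets of sequences -/

/-- A set of sequences is semidecidable if some oracle machine outputs `0` at some place exactly
for the oracles in the set. -/
def SemiDec (U : (ℕ → ℕ) → Prop) : Prop :=
  ∃ Φ, RecursiveFunctional Φ ∧ ∀ p, U p ↔ ∃ n, 0 ∈ Φ p n

theorem SemiDec.of_total {g : (ℕ → ℕ) → ℕ → ℕ} (hg : TotalRecursive g) :
    SemiDec fun p => ∃ n, g p n = 0 :=
  ⟨_, TotalRecursive.nat_iff.1 hg, fun p => by simp [eq_comm]⟩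

/-- The test looks for an output `0` at some place below the length of the prefix. Monotonicity of
the approximation allows the prefix to be lengthened until that place is in range. -/
theorem SemiDec.exists_list {U : (ℕ → ℕ) → Prop} (hU : SemiDec U) :
    ∃ c : List ℕ → Bool, Primrec c ∧ ∀ p, U p ↔ ∃ k, c (prefixOf p k) = true := by
  obtain ⟨Φ, hΦ, hU⟩ := hU
  obtain ⟨φ, hφ⟩ := hΦ.exists_approximates
  refine ⟨fun l => decide ((List.range l.length).findIdx (fun n => decide (φ l n = some 0)) < l.length),
    ?_, fun p => ?_⟩
  · refine (Primrec.nat_lt.comp (Primrec.list_findIdx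
      (Primrec.list_range.comp Primrec.list_length) ?_) Primrec.list_length).decide
    exact (Primrec.eq.comp (hφ.primrec.comp Primrec.fst Primrec.snd) (Primrec.const _)).decide
  · have key : ∀ l : List ℕ, (List.range l.length).findIdx (fun n => decide (φ l n = some 0)) < l.length ↔
        ∃ n < l.length, φ l n = some 0 := by
      intro l
      have := List.findIdx_lt_length (p := fun n => decide (φ l n = some 0)) (xs := List.range l.length)
      simpa using this
    simp only [decide_eq_true_eq, key, hU, hφ.mem_iff]
    simp only [prefixOf_length]
    constructor
    · rintro ⟨n, k, h⟩
      exact ⟨n + 1 + k, n, by omega, hφ.mono _ _ _ _ _ (by omega) h⟩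
    · rintro ⟨k, n, -, h⟩
      exact ⟨n, k, h⟩

theorem SemiDec.of_list {c : List ℕ → Bool} (hc : Primrec c) :
    SemiDec fun p => ∃ k, c (prefixOf p k) = true := by
  have h : TotalRecursive fun p k => if c (Weihrauch.prefixOf p k) = true then 0 else 1 :=
    (TotalRecursive.prefixOf .oracle).primrec_comp
      (f := fun l => if c l = true then 0 else 1)
      (Primrec.ite (Primrec.eq.comp hc (Primrec.const _)) (Primrec.const _) (Primrec.const _))
  simpa using SemiDec.of_total h

/-- Prefix tests are total, so a pointwise `||` replaces dovetailing. -/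
theorem SemiDec.or {U V : (ℕ → ℕ) → Prop} (hU : SemiDec U) (hV : SemiDec V) :
    SemiDec fun p => U p ∨ V p := by
  obtain ⟨c, hc, hU⟩ := hU.exists_list
  obtain ⟨d, hd, hV⟩ := hV.exists_list
  have h := SemiDec.of_list (c := fun l => c l || d l) (Primrec.or.comp hc hd)
  simpa only [Bool.or_eq_true, exists_or, ← hU, ← hV] using h

/-- Nothing is claimed about `V` outside the domain of `F`, where the substituted machine may do
anything. -/
theorem SemiDec.subst {U : (ℕ → ℕ) → Prop} (hU : SemiDec U) {F : (ℕ → ℕ) →. (ℕ → ℕ)}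
    (hF : ComputableOnBaire F) : ∃ V, SemiDec V ∧ ∀ p, ∀ r ∈ F p, (V p ↔ U r) := by
  obtain ⟨Ψ, hΨ, hU⟩ := hU
  obtain ⟨Φ, hΦ, hF⟩ := hF
  obtain ⟨Θ, hΘ, h⟩ := hΨ.subst hΦ
  exact ⟨_, ⟨Θ, hΘ, fun _ => Iff.rfl⟩, fun p r hr => by rw [hU, h p r (hF p r hr)]⟩

/-- For `r = ⟨p, q⟩`: the partial function with code `p` takes the value `0` somewhere on `q`. -/
def Fires (r : ℕ → ℕ) : Prop :=
  ∃ n, 0 ∈ evalCode (fun i => r (2 * i)) (fun i => r (2 * i + 1)) n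

theorem semiDec_fires : SemiDec Fires :=
  ⟨_, recursiveFunctional_evalCode, fun _ => Iff.rfl⟩

theorem fires_pairing {p q : ℕ → ℕ} : Fires (pairing p q) ↔ ∃ n, 0 ∈ evalCode p q n := by
  simp only [Fires, pairing_even, pairing_odd]

/-! ### Computable functions on Baire space -/

theorem TotalRecursive.pairing {f g : (ℕ → ℕ) → ℕ → ℕ} (hf : TotalRecursive f)
    (hg : TotalRecursive g) : TotalRecursive fun p => pairing (f p) (g p) := by
  have hdiv : TotalRecursive fun (_ : ℕ → ℕ) (n : ℕ) => n / 2 :=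
    .of_primrec (Primrec.nat_div.comp Primrec.id (Primrec.const 2))
  refine .primrec_comp (f := fun x : ℕ × ℕ × ℕ => if x.1 % 2 = 0 then x.2.1 else x.2.2) ?_
    (.pair .arg (.pair (hf.comp hdiv) (hg.comp hdiv)))
  exact Primrec.ite (Primrec.eq.comp (Primrec.nat_mod.comp Primrec.fst (Primrec.const 2))
    (Primrec.const 0)) (Primrec.fst.comp Primrec.snd) (Primrec.snd.comp Primrec.snd)

theorem TotalRecursive.evens {f : (ℕ → ℕ) → ℕ → ℕ} (hf : TotalRecursive f) :
    TotalRecursive fun p n => f p (2 * n) :=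
  hf.comp (.of_primrec Primrec.nat_double)

theorem TotalRecursive.odds {f : (ℕ → ℕ) → ℕ → ℕ} (hf : TotalRecursive f) :
    TotalRecursive fun p n => f p (2 * n + 1) :=
  hf.comp (.of_primrec Primrec.nat_double_succ)

theorem ComputableOnBaire.of_total {g : (ℕ → ℕ) → ℕ → ℕ} (hg : TotalRecursive g) :
    ComputableOnBaire fun p => Part.some (g p) := by
  refine ⟨_, TotalRecursive.nat_iff.1 hg, fun p q hq n => ?_⟩
  obtain rfl := Part.mem_some_iff.1 hq
  exact Part.mem_some _

theorem ComputableOnBaire.bind {F G : (ℕ → ℕ) →. (ℕ → ℕ)} (hF : ComputableOnBaire F)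
    (hG : ComputableOnBaire G) : ComputableOnBaire fun p => (F p).bind G := by
  obtain ⟨Φ, hΦ, hF⟩ := hF
  obtain ⟨Ψ, hΨ, hG⟩ := hG
  obtain ⟨Θ, hΘ, h⟩ := hΨ.subst hΦ
  refine ⟨Θ, hΘ, fun p q hq n => ?_⟩
  obtain ⟨r, hr, hq⟩ := Part.mem_bind_iff.1 hq
  rw [h p r (hF p r hr)]
  exact hG r q hq n

theorem ComputableOnBaire.comp_total {F : (ℕ → ℕ) →. (ℕ → ℕ)} {g : (ℕ → ℕ) → ℕ → ℕ}
    (hF : ComputableOnBaire F) (hg : TotalRecursive g) : ComputableOnBaire fun p => F (g p) := by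
  have h := (ComputableOnBaire.of_total hg).bind hF
  have e : (fun p => (Part.some (g p)).bind F) = fun p => F (g p) :=
    funext fun p => Part.bind_some (g p) F
  exact e ▸ h

/-- The pairing of two partial functions on Baire space. -/
def pairPart (x y : Part (ℕ → ℕ)) : Part (ℕ → ℕ) :=
  x.bind fun a => y.map fun b => pairing a b

theorem mem_pairPart {x y : Part (ℕ → ℕ)} {a b : ℕ → ℕ} (ha : a ∈ x) (hb : b ∈ y) :
    pairing a b ∈ pairPart x y :=
  Part.mem_bind ha (Part.mem_map _ hb)

theorem ComputableOnBaire.pairPart {F G : (ℕ → ℕ) →. (ℕ → ℕ)} (hF : ComputableOnBaire F)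
    (hG : ComputableOnBaire G) : ComputableOnBaire fun p => pairPart (F p) (G p) := by
  obtain ⟨Φ, hΦ, hF⟩ := hF
  obtain ⟨Ψ, hΨ, hG⟩ := hG
  have hdiv : Nat.Primrec fun n => n / 2 :=
    Primrec.nat_iff.1 (Primrec.nat_div.comp Primrec.id (Primrec.const 2))
  have hsel : Nat.Primrec fun m => if m.unpair.1 % 2 = 0 then m.unpair.2.unpair.1
      else m.unpair.2.unpair.2 := by
    have h2 := Primrec.unpair.comp (Primrec.snd.comp Primrec.unpair)
    exact Primrec.nat_iff.1 (Primrec.ite (Primrec.eq.comp (Primrec.nat_mod.comp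
      (Primrec.fst.comp Primrec.unpair) (Primrec.const 2)) (Primrec.const 0))
      (Primrec.fst.comp h2) (Primrec.snd.comp h2))
  have hd := RecursiveFunctional.of_primrec hdiv
  -- Both components are evaluated at `n / 2` before the parity selects one; this terminates because
  -- both sequences exist.
  refine ⟨_, (RecursiveFunctional.of_primrec hsel).comp
    ((RecursiveFunctional.of_primrec Nat.Primrec.id).pair ((hΦ.comp_total hd).pair
      (hΨ.comp_total hd))), fun p q hq n => ?_⟩
  obtain ⟨a, ha, hq⟩ := Part.mem_bind_iff.1 hq
  obtain ⟨b, hb, rfl⟩ := (Part.mem_map_iff _).1 hq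
  refine Part.mem_bind_iff.2 ⟨Nat.pair n (Nat.pair (a (n / 2)) (b (n / 2))), ?_, ?_⟩
  · have h1 := Part.eq_some_iff.2 (hF p a ha (n / 2))
    have h2 := Part.eq_some_iff.2 (hG p b hb (n / 2))
    simp [h1, h2, Seq.seq]
  · simp [pairing]

/-! ### Codes of semidecidable sets -/

/-- The sections of a semidecidable set have codes that are computable in the parameter. -/
theorem SemiDec.exists_code {U : (ℕ → ℕ) → Prop} (hU : SemiDec U) :
    ∃ h : (ℕ → ℕ) → ℕ → ℕ, TotalRecursive h ∧
      ∀ p q, ∃ t ∈ codedMap (h p) q, ((∃ n, t n = 0) ↔ U (pairing p q)) := by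
  obtain ⟨c, hc, hU⟩ := hU.exists_list
  -- Rebuilds the first `n` entries of `⟨p, q⟩`; entry `i` needs only index `i / 2` of a component,
  -- so prefixes of length `n` suffice.
  let inter : List ℕ → List ℕ → ℕ → List ℕ := fun l w n => (List.range n).map fun i =>
    if i % 2 = 0 then l.getD (i / 2) 0 else w.getD (i / 2) 0
  have hinter : Primrec fun x : List ℕ × List ℕ × ℕ => inter x.1 x.2.1 x.2.2 := by
    refine Primrec.list_map (Primrec.list_range.comp (Primrec.snd.comp Primrec.snd)) ?_
    have hdiv : Primrec fun x : (List ℕ × List ℕ × ℕ) × ℕ => x.2 / 2 :=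
      Primrec.nat_div.comp Primrec.snd (Primrec.const 2)
    exact Primrec.ite (Primrec.eq.comp (Primrec.nat_mod.comp Primrec.snd (Primrec.const 2))
      (Primrec.const 0)) ((Primrec.list_getD 0).comp (Primrec.fst.comp Primrec.fst) hdiv)
      ((Primrec.list_getD 0).comp (Primrec.fst.comp (Primrec.snd.comp Primrec.fst)) hdiv)
  let dec : ℕ → List ℕ := fun e => (Encodable.decode e).getD []
  have hdec : Primrec dec := Primrec.option_getD.comp Primrec.decode (Primrec.const [])
  -- The code at `⟨n, w⟩` is `0` (read on) until `w` has length at least `n`; then `1` or `2`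
  -- announces the output `0` or `1`, according to the test on the first `n` entries of `⟨p, q⟩`.
  -- The coded function is thus total.
  let out : List ℕ × ℕ → ℕ := fun x =>
    if x.2.unpair.1 ≤ (dec x.2.unpair.2).length then
      if c (inter x.1 (dec x.2.unpair.2) x.2.unpair.1) = true then 1 else 2
    else 0
  have hout : Primrec out := by
    have hn : Primrec fun x : List ℕ × ℕ => x.2.unpair.1 :=
      Primrec.fst.comp (Primrec.unpair.comp Primrec.snd)
    have hw : Primrec fun x : List ℕ × ℕ => dec x.2.unpair.2 :=
      hdec.comp (Primrec.snd.comp (Primrec.unpair.comp Primrec.snd))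
    exact Primrec.ite (Primrec.nat_le.comp hn (Primrec.list_length.comp hw))
      (Primrec.ite (Primrec.eq.comp (hc.comp (hinter.comp (Primrec.fst.pair (hw.pair hn))))
        (Primrec.const _)) (Primrec.const _) (Primrec.const _)) (Primrec.const _)
  refine ⟨fun p m => out (prefixOf p m.unpair.1, m), ?_, fun p q => ?_⟩
  · exact .primrec_comp hout (.pair (.comp (.prefixOf .oracle)
      (.of_primrec (Primrec.fst.comp Primrec.unpair))) .arg)
  have hi : ∀ n k, n ≤ k → inter (prefixOf p n) (prefixOf q k) n = prefixOf (pairing p q) n := by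
    intro n k hk
    refine List.map_congr_left fun i hi => ?_
    rw [List.mem_range] at hi
    have hi2 : i / 2 < n := by omega
    have hi3 : i / 2 < k := by omega
    simp [pairing, prefixOf, hi2, hi3]
  have ho : ∀ n k, out (prefixOf p (Nat.pair n (Encodable.encode (prefixOf q k))).unpair.1,
      Nat.pair n (Encodable.encode (prefixOf q k))) =
        if n ≤ k then if c (prefixOf (pairing p q) n) = true then 1 else 2 else 0 := by
    intro n k
    simp only [out, dec, Nat.unpair_pair, Encodable.encodek, Option.getD_some, prefixOf_length]
    split_ifs with h1 <;> simp_all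
  have he : ∀ n, (if c (prefixOf (pairing p q) n) = true then 0 else 1) ∈
      evalCode (fun m => out (prefixOf p m.unpair.1, m)) q n := by
    intro n
    have hval : ∀ k, ∀ m ∈ Nat.ppred (out (prefixOf p
        (Nat.pair n (Encodable.encode (prefixOf q k))).unpair.1,
        Nat.pair n (Encodable.encode (prefixOf q k)))),
        m = if c (prefixOf (pairing p q) n) = true then 0 else 1 := by
      intro k m
      rw [ho]
      split_ifs <;> simp [eq_comm]
    have hd : (evalCode (fun m => out (prefixOf p m.unpair.1, m)) q n).Dom := by
      refine Nat.rfindOpt_dom.2 ⟨n, if c (prefixOf (pairing p q) n) = true then 0 else 1, ?_⟩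
      have := ho n n
      simp only [le_rfl, if_true] at this
      simp only [this]
      split_ifs <;> simp
    obtain ⟨k, hk⟩ := Nat.rfindOpt_spec (Part.get_mem hd)
    exact hval k _ hk ▸ Part.get_mem hd
  refine ⟨fun n => if c (prefixOf (pairing p q) n) = true then 0 else 1,
    ⟨fun n => (he n).1, funext fun n => (he n).2⟩, ?_⟩
  rw [hU]
  simp

theorem mem_codedMap {p q r : ℕ → ℕ} : r ∈ codedMap p q ↔ ∀ n, r n ∈ evalCode p q n := by
  constructor
  · rintro ⟨h, rfl⟩ n
    exact Part.get_mem (h n)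
  · exact fun h => ⟨fun n => (h n).1, funext fun n => (h n).2⟩

theorem eventually_prefix_eq (q : ℕ → ℕ) (k : ℕ) : ∀ᶠ q' in 𝓝 q, ∀ i < k, q' i = q i := by
  refine (Set.finite_lt_nat k).eventually_all.2 fun i _ => ?_
  exact ((continuous_apply (A := fun _ : ℕ => ℕ) i).tendsto q).eventually_mem (s := {q i}) (by simp)

/-- The `n`-th value is found after reading finitely many entries of the argument, and arguments
that agree on these run through the same search. -/
theorem continuous_codedMap (p : ℕ → ℕ) : Continuous (codedMap p).asSubtype := by
  refine continuous_pi fun n => continuous_iff_continuousAt.2 fun z => ?_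
  refine tendsto_nhds_of_eventually_eq ?_
  have hz : (codedMap p).asSubtype z n ∈ evalCode p z.1 n := Part.get_mem (z.2 n)
  obtain ⟨k, hk, hm⟩ := Part.mem_bind_iff.1 hz
  filter_upwards [(continuous_subtype_val.tendsto z).eventually (eventually_prefix_eq z.1 (k + 1))]
    with z' hz'
  have hpre : ∀ j ≤ k, prefixOf z'.1 j = prefixOf z.1 j := fun j hj =>
    prefixOf_eq_iff.2 fun i hi => hz' i (by omega)
  refine Part.mem_unique (Part.get_mem (z'.2 n)) (Part.mem_bind_iff.2 ⟨k, ?_, ?_⟩)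
  · obtain ⟨h1, h2⟩ := Nat.mem_rfind.1 hk
    refine Nat.mem_rfind.2 ⟨?_, fun {j} hj => ?_⟩
    · simpa only [hpre k le_rfl] using h1
    · simpa only [hpre j hj.le] using h2 hj
  · simpa only [hpre k le_rfl] using hm

/-! ### Names of closed sets -/

/-- The function coded by `r` is itself a continuous realizer, so closedness of `C` needs no
separate proof. -/
theorem exists_closedSet {X : Type u} [RepresentedSpace X] {r : ℕ → ℕ} {C : Set X}
    (h : ∀ q, ∀ x ∈ RepresentedSpace.δ (X := X) q,
      ∃ t ∈ codedMap r q, ((∃ n, t n = 0) ↔ x ∉ C)) :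
    ∃ D : ClosedSet X, D.1 = C ∧ D ∈ RepresentedSpace.δ r := by
  have hr : Realizes (codedMap r) fun x => {x ∉ C} := by
    intro q x hx _
    obtain ⟨t, ht, h⟩ := h q x hx
    exact ⟨t, ht, _, Part.mem_some _, propext h⟩
  exact ⟨⟨C, codedMap r, continuous_codedMap r, hr⟩, rfl, mem_δ_closedSet.2 hr⟩

/-- The coded function sends `q` to a Sierpinski name of `x ∉ C`, which denotes truth iff it
contains a `0`. -/
theorem fires_iff_of_mem_δ {X : Type u} [RepresentedSpace X] {r q : ℕ → ℕ} {C : ClosedSet X} {x : X}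
    (hC : C ∈ RepresentedSpace.δ r) (hx : x ∈ RepresentedSpace.δ (X := X) q) :
    Fires (pairing r q) ↔ x ∉ C.1 := by
  obtain ⟨t, ht, y, hy, rfl⟩ := mem_δ_closedSet.1 hC q x hx ⟨_, rfl⟩
  have ht := mem_codedMap.1 ht
  rw [fires_pairing, Part.mem_some_iff.1 hy]
  exact exists_congr fun n =>
    ⟨fun h => Part.mem_unique (ht n) h, fun h => h ▸ ht n⟩

theorem mem_δ_prod {X : Type u} {Y : Type v} [RepresentedSpace X] [RepresentedSpace Y]
    {r : ℕ → ℕ} {z : X × Y} : z ∈ RepresentedSpace.δ r ↔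
      z.1 ∈ RepresentedSpace.δ (X := X) (fun n => r (2 * n)) ∧
      z.2 ∈ RepresentedSpace.δ (X := Y) (fun n => r (2 * n + 1)) := by
  constructor
  · intro h
    obtain ⟨x, hx, h⟩ := Part.mem_bind_iff.1 h
    obtain ⟨y, hy, rfl⟩ := (Part.mem_map_iff _).1 h
    exact ⟨hx, hy⟩
  · exact fun h => Part.mem_bind h.1 (Part.mem_map _ h.2)

theorem pairing_mem_δ {X : Type u} {Y : Type v} [RepresentedSpace X] [RepresentedSpace Y]
    {p q : ℕ → ℕ} {x : X} {y : Y} (hx : x ∈ RepresentedSpace.δ (X := X) p)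
    (hy : y ∈ RepresentedSpace.δ (X := Y) q) :
    (x, y) ∈ RepresentedSpace.δ (pairing p q) :=
  mem_δ_prod.2 (by simpa only [pairing_even, pairing_odd] using ⟨hx, hy⟩)

/-! ### Characterizations of Weihrauch reducibility -/

theorem mem_multiDom_multiProd {X Y U V : Type*} {f : X → Set Y} {g : U → Set V} {x : X × U} :
    x ∈ multiDom (multiProd f g) ↔ x.1 ∈ multiDom f ∧ x.2 ∈ multiDom g :=
  Set.prod_nonempty_iff

section
variable {X Y U V P Q : Type*} [RepresentedSpace X] [RepresentedSpace Y]
  [RepresentedSpace U] [RepresentedSpace V] [RepresentedSpace P] [RepresentedSpace Q]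

/-- Realizers are arbitrary functions, so any name of any solution is the answer of some realizer;
quantifying over realizers amounts to quantifying over solutions. -/
theorem weihrauchLE_iff {f : X → Set Y} {g : U → Set V} :
    WeihrauchLE f g ↔ ∃ K H, ComputableOnBaire K ∧ ComputableOnBaire H ∧
      ∀ p, ∀ x ∈ RepresentedSpace.δ (X := X) p, x ∈ multiDom f →
        ∃ r ∈ H p, ∃ u ∈ RepresentedSpace.δ (X := U) r, u ∈ multiDom g ∧
          ∀ s, ∀ v ∈ RepresentedSpace.δ (X := V) s, v ∈ g u →
            ∃ t ∈ K (pairing p s), ∃ y ∈ RepresentedSpace.δ (X := Y) t, y ∈ f x := by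
  classical
  constructor
  · rintro ⟨K, H, hK, hH, h⟩
    refine ⟨K, H, hK, hH, fun p x hx hd => ?_⟩
    have hG : ∀ r, ∃ s, ∀ u ∈ RepresentedSpace.δ (X := U) r, u ∈ multiDom g →
        ∃ v ∈ RepresentedSpace.δ (X := V) s, v ∈ g u := by
      intro r
      by_cases hu : ∃ u ∈ RepresentedSpace.δ (X := U) r, u ∈ multiDom g
      · obtain ⟨u, hu, v, hv⟩ := hu
        obtain ⟨s, hs⟩ := RepresentedSpace.surj v
        exact ⟨s, fun u' hu' _ => ⟨v, hs, Part.mem_unique hu hu' ▸ hv⟩⟩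
      · exact ⟨r, fun u h1 h2 => absurd ⟨u, h1, h2⟩ hu⟩
    choose G hG using hG
    let D : (ℕ → ℕ) → Prop := fun r => ∃ u ∈ RepresentedSpace.δ (X := U) r, u ∈ multiDom g
    -- This realizer is defined only on names of points of `dom g`, so definedness of the composite
    -- forces `r` to be such a name.
    have h0 : Realizes (fun r => ⟨D r, fun _ => G r⟩) g := fun r u hu hd =>
      ⟨G r, ⟨⟨u, hu, hd⟩, rfl⟩, hG r u hu hd⟩
    obtain ⟨t, ht, -⟩ := h _ h0 p x hx hd
    obtain ⟨r, hr, ht⟩ := Part.mem_bind_iff.1 ht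
    obtain ⟨_, ⟨⟨u, hu, hud⟩, -⟩, -⟩ := Part.mem_bind_iff.1 ht
    refine ⟨r, hr, u, hu, hud, fun s v hv hvg => ?_⟩
    -- Altering the realizer at `r` alone prescribes the answer `s`.
    have h1 : Realizes (fun r' => Part.some (if r' = r then s else G r')) g := by
      intro r' u' hu' hd'
      refine ⟨_, Part.mem_some _, ?_⟩
      split_ifs with he
      · subst he
        exact ⟨v, hv, Part.mem_unique hu hu' ▸ hvg⟩
      · exact hG r' u' hu' hd'
    obtain ⟨t, ht, h⟩ := h _ h1 p x hx hd
    obtain ⟨r', hr', ht⟩ := Part.mem_bind_iff.1 ht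
    obtain rfl := Part.mem_unique hr hr'
    obtain ⟨s', hs', ht⟩ := Part.mem_bind_iff.1 ht
    simp only [if_true, Part.mem_some_iff] at hs'
    exact ⟨t, hs' ▸ ht, h⟩
  · rintro ⟨K, H, hK, hH, h⟩
    refine ⟨K, H, hK, hH, fun G hG p x hx hd => ?_⟩
    obtain ⟨r, hr, u, hu, hud, h⟩ := h p x hx hd
    obtain ⟨s, hs, v, hv, hvg⟩ := hG r u hu hud
    obtain ⟨t, ht, h⟩ := h s v hv hvg
    exact ⟨t, Part.mem_bind hr (Part.mem_bind hs ht), h⟩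

/-- `W` recognises wrong guesses and `K` uses right ones. Evaluating the code `H p` gives `W` from a
reduction; conversely `SemiDec.exists_code` turns the sections of `W` into names of closed sets. -/
theorem weihrauchLE_closedChoice_iff {f : X → Set Y} :
    WeihrauchLE f (closedChoice V) ↔ ∃ W K, SemiDec W ∧ ComputableOnBaire K ∧
      ∀ p, ∀ x ∈ RepresentedSpace.δ (X := X) p, x ∈ multiDom f →
        ∃ C : Set V, C.Nonempty ∧ ∀ q, ∀ v ∈ RepresentedSpace.δ (X := V) q,
          (W (pairing p q) ↔ v ∉ C) ∧
          (v ∈ C → ∃ t ∈ K (pairing p q), ∃ y ∈ RepresentedSpace.δ (X := Y) t, y ∈ f x) := by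
  rw [weihrauchLE_iff]
  constructor
  · rintro ⟨K, H, hK, hH, h⟩
    obtain ⟨W, hW, hWF⟩ := semiDec_fires.subst ((hH.comp_total (.evens .oracle)).pairPart
      (.of_total (.odds .oracle)))
    refine ⟨W, K, hW, hK, fun p x hx hd => ?_⟩
    obtain ⟨r, hr, C, hC, hCd, h⟩ := h p x hx hd
    refine ⟨C.1, hCd, fun q v hv => ⟨?_, h q v hv⟩⟩
    rw [← fires_iff_of_mem_δ hC hv]
    refine hWF _ _ (mem_pairPart ?_ ?_)
    · simpa only [pairing_even] using hr
    · simp only [pairing_odd, Part.mem_some_iff]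
  · rintro ⟨W, K, hW, hK, h⟩
    obtain ⟨c, hc, hcW⟩ := hW.exists_code
    refine ⟨K, _, hK, .of_total hc, fun p x hx hd => ?_⟩
    obtain ⟨C, hCn, h⟩ := h p x hx hd
    have hC : ∀ q, ∀ v ∈ RepresentedSpace.δ (X := V) q,
        ∃ t ∈ codedMap (c p) q, ((∃ n, t n = 0) ↔ v ∉ C) := by
      intro q v hv
      obtain ⟨t, ht, h'⟩ := hcW p q
      exact ⟨t, ht, h'.trans (h q v hv).1⟩
    obtain ⟨D, rfl, hD⟩ := exists_closedSet hC
    exact ⟨_, Part.mem_some _, D, hD, hCn, fun q v hv hvD => (h q v hv).2 hvD⟩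

theorem WeihrauchLE.trans {f : X → Set Y} {g : U → Set V} {h : P → Set Q}
    (hfg : WeihrauchLE f g) (hgh : WeihrauchLE g h) : WeihrauchLE f h := by
  rw [weihrauchLE_iff] at *
  obtain ⟨K1, H1, hK1, hH1, h1⟩ := hfg
  obtain ⟨K2, H2, hK2, hH2, h2⟩ := hgh
  -- From `⟨p, s⟩`, the outer functional recomputes `r = H1 p`, obtains `t` from `K2 ⟨r, s⟩` and
  -- applies `K1` to `⟨p, t⟩`.
  refine ⟨_, _, ((ComputableOnBaire.of_total (.evens .oracle)).pairPart
    (((hH1.comp_total (.evens .oracle)).pairPart (.of_total (.odds .oracle))).bind hK2)).bind hK1,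
    hH1.bind hH2, fun p x hx hd => ?_⟩
  obtain ⟨r, hr, u, hu, hud, h1⟩ := h1 p x hx hd
  obtain ⟨r', hr', u', hu', hud', h2⟩ := h2 r u hu hud
  refine ⟨r', Part.mem_bind hr hr', u', hu', hud', fun s v hv hvh => ?_⟩
  obtain ⟨t, ht, y, hy, hyg⟩ := h2 s v hv hvh
  obtain ⟨t', ht', h1⟩ := h1 t y hy hyg
  refine ⟨t', Part.mem_bind (mem_pairPart (Part.mem_some_iff.2 ?_)
    (Part.mem_bind (mem_pairPart (a := r) (b := s) ?_ ?_) ht)) ht', h1⟩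
  · simp only [pairing_even]
  · simpa only [pairing_even] using hr
  · simp only [pairing_odd, Part.mem_some_iff]

theorem WeihrauchLE.multiProd {f : X → Set Y} {g : U → Set V} {X' Y' U' V' : Type*}
    [RepresentedSpace X'] [RepresentedSpace Y'] [RepresentedSpace U'] [RepresentedSpace V']
    {f' : X' → Set Y'} {g' : U' → Set V'}
    (hf : WeihrauchLE f f') (hg : WeihrauchLE g g') :
    WeihrauchLE (multiProd f g) (multiProd f' g') := by
  rw [weihrauchLE_iff] at *
  obtain ⟨K1, H1, hK1, hH1, h1⟩ := hf
  obtain ⟨K2, H2, hK2, hH2, h2⟩ := hg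
  refine ⟨_, _,
    (hK1.comp_total (.pairing (.evens (.evens .oracle)) (.evens (.odds .oracle)))).pairPart
      (hK2.comp_total (.pairing (.odds (.evens .oracle)) (.odds (.odds .oracle)))),
    (hH1.comp_total (.evens .oracle)).pairPart (hH2.comp_total (.odds .oracle)),
    fun p x hx hd => ?_⟩
  rw [mem_δ_prod] at hx
  rw [mem_multiDom_multiProd] at hd
  obtain ⟨r, hr, u, hu, hud, h1⟩ := h1 _ _ hx.1 hd.1
  obtain ⟨r', hr', u', hu', hud', h2⟩ := h2 _ _ hx.2 hd.2
  refine ⟨_, mem_pairPart hr hr', _, pairing_mem_δ hu hu',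
    mem_multiDom_multiProd.2 ⟨hud, hud'⟩, fun s v hv hvh => ?_⟩
  rw [mem_δ_prod] at hv
  obtain ⟨t, ht, y, hy, hyg⟩ := h1 _ _ hv.1 hvh.1
  obtain ⟨t', ht', y', hy', hyg'⟩ := h2 _ _ hv.2 hvh.2
  refine ⟨_, mem_pairPart ?_ ?_, _, pairing_mem_δ hy hy', hyg, hyg'⟩
  · simpa only [pairing_even, pairing_odd] using ht
  · simpa only [pairing_even, pairing_odd] using ht'

theorem weihrauchLE_multiProd_self (f : X → Set Y) : WeihrauchLE f (multiProd f f) := by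
  rw [weihrauchLE_iff]
  refine ⟨_, _, .of_total (.evens (.odds .oracle)), .of_total (.pairing .oracle .oracle),
    fun p x hx hd => ⟨_, Part.mem_some _, _, pairing_mem_δ hx hx,
      mem_multiDom_multiProd.2 ⟨hd, hd⟩, fun s v hv hvf => ⟨_, Part.mem_some _, v.1, ?_, hvf.1⟩⟩⟩
  simpa only [pairing_odd] using (mem_δ_prod.1 hv).1

/-! ### Reductions between closed choice problems -/

/-- A box is left as soon as one coordinate leaves its side, so boxes of closed sets are closed
uniformly in names. -/
theorem multiProd_closedChoice_le :
    WeihrauchLE (multiProd (closedChoice X) (closedChoice Y)) (closedChoice (X × Y)) := by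
  rw [weihrauchLE_closedChoice_iff]
  obtain ⟨W1, hW1, h1⟩ := semiDec_fires.subst (.of_total
    (.pairing (.evens (.evens .oracle)) (.evens (.odds .oracle))))
  obtain ⟨W2, hW2, h2⟩ := semiDec_fires.subst (.of_total
    (.pairing (.odds (.evens .oracle)) (.odds (.odds .oracle))))
  refine ⟨_, _, hW1.or hW2, .of_total (.odds .oracle), fun p x hx hd => ?_⟩
  rw [mem_δ_prod] at hx
  refine ⟨x.1.1 ×ˢ x.2.1, hd, fun q v hv => ⟨?_, fun hvC => ⟨_, Part.mem_some _, v, ?_, hvC⟩⟩⟩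
  · rw [mem_δ_prod] at hv
    rw [h1 _ _ (Part.mem_some _), h2 _ _ (Part.mem_some _)]
    simp only [pairing_even, pairing_odd]
    rw [fires_iff_of_mem_δ hx.1 hv.1, fires_iff_of_mem_δ hx.2 hv.2, Set.mem_prod, not_and_or]
  · simpa only [pairing_odd] using hv

/-- Choose in the preimage, which is closed since `s` is computable and nonempty since `s` is onto;
then apply `s`. -/
theorem closedChoice_le_of_surjective {s : X → Y} (hs : IsComputableMap s)
    (hsurj : Function.Surjective s) : WeihrauchLE (closedChoice Y) (closedChoice X) := by
  rw [weihrauchLE_closedChoice_iff]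
  obtain ⟨F, hF, hFs⟩ := hs
  have hF' := hF.comp_total (.odds .oracle)
  obtain ⟨W, hW, h⟩ := semiDec_fires.subst
    ((ComputableOnBaire.of_total (.evens .oracle)).pairPart hF')
  refine ⟨W, _, hW, hF', fun p C hC hd => ⟨s ⁻¹' C.1, hd.preimage hsurj, fun q v hv => ?_⟩⟩
  obtain ⟨r, hr, y, hy, rfl⟩ := hFs q v hv ⟨_, rfl⟩
  refine ⟨?_, fun hvC => ⟨r, by simpa only [pairing_odd] using hr, s v, hy, hvC⟩⟩
  rw [h _ (pairing p r) (mem_pairPart ?_ ?_), fires_iff_of_mem_δ hC hy]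
  · rfl
  · simp only [pairing_even, Part.mem_some_iff]
  · simpa only [pairing_odd] using hr

/-- Closed choice on `X` reduces to closed choice on `Y`, if `X` can be embedded into `Y` with a
computable partial inverse and a co-semidecidable range. -/
theorem closedChoice_le_of_embedding {ι : X → Y} {E : (ℕ → ℕ) →. (ℕ → ℕ)}
    {T : (ℕ → ℕ) → Prop} (hE : ComputableOnBaire E) (hT : SemiDec T)
    (hEι : ∀ q x, ι x ∈ RepresentedSpace.δ (X := Y) q →
      ∃ r ∈ E q, x ∈ RepresentedSpace.δ (X := X) r)
    (hTι : ∀ q, ∀ y ∈ RepresentedSpace.δ (X := Y) q, (T q ↔ y ∉ Set.range ι)) :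
    WeihrauchLE (closedChoice X) (closedChoice Y) := by
  rw [weihrauchLE_closedChoice_iff]
  have hE' := hE.comp_total (.odds .oracle)
  obtain ⟨W1, hW1, h1⟩ := hT.subst (.of_total (.odds .oracle))
  obtain ⟨W2, hW2, h2⟩ := semiDec_fires.subst
    ((ComputableOnBaire.of_total (.evens .oracle)).pairPart hE')
  refine ⟨_, _, hW1.or hW2, hE', fun p C hC hd => ⟨ι '' C.1, hd.image _, fun q y hy => ⟨?_, ?_⟩⟩⟩
  · rw [h1 _ _ (Part.mem_some _)]
    simp only [pairing_odd]
    rw [hTι q y hy]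
    by_cases hyr : y ∈ Set.range ι
    · obtain ⟨x, rfl⟩ := hyr
      obtain ⟨r, hr, hx⟩ := hEι q x hy
      -- Injectivity of `ι` is forced by `E`, which computes the preimage from a name of the image.
      have hinj : ∀ x', ι x' = ι x → x' = x := by
        intro x' he
        obtain ⟨r', hr', hx'⟩ := hEι q x' (he ▸ hy)
        obtain rfl := Part.mem_unique hr hr'
        exact Part.mem_unique hx' hx
      rw [h2 _ (pairing p r) (mem_pairPart ?_ ?_), fires_iff_of_mem_δ hC hx]
      · simp only [Set.mem_range_self, not_true_eq_false, false_or, not_iff_not]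
        exact ⟨fun h => ⟨x, h, rfl⟩, fun ⟨x', h, he⟩ => hinj x' he ▸ h⟩
      · simp only [pairing_even, Part.mem_some_iff]
      · simpa only [pairing_odd] using hr
    · simp only [hyr, not_false_eq_true, true_or, true_iff]
      exact fun h => hyr (Set.image_subset_range _ _ h)
  · rintro ⟨x, hx, rfl⟩
    obtain ⟨r, hr, hxr⟩ := hEι q x hy
    exact ⟨r, by simpa only [pairing_odd] using hr, x, hxr, hx⟩

end

/-! ### Independent choice and its consequences -/

theorem mem_δ_subtype {A : Set (ℕ → ℕ)} {p : ℕ → ℕ} {a : A} :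
    a ∈ RepresentedSpace.δ (X := A) p ↔ p = a := by
  constructor
  · rintro ⟨h, rfl⟩
    rfl
  · rintro rfl
    exact ⟨a.2, rfl⟩

/-- Independent choice. -/
theorem multiComp_le_closedChoice_prod {A B : Set (ℕ → ℕ)} {X : Type u} {Y : Type v} {Z : Type w}
    [RepresentedSpace X] [RepresentedSpace Y] [RepresentedSpace Z] {f : Y → Set Z} {g : X → Set Y}
    (hf : WeihrauchLE f (closedChoice A)) (hg : WeihrauchLE g (closedChoice B)) :
    WeihrauchLE (multiComp f g) (closedChoice (A × B)) := by
  rw [weihrauchLE_closedChoice_iff] at *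
  obtain ⟨W1, K1, hW1, hK1, h1⟩ := hf
  obtain ⟨W2, K2, hW2, hK2, h2⟩ := hg
  -- From `⟨p, ⟨a, b⟩⟩`, `hpb` extracts `⟨p, b⟩`, and `hya` forms `⟨t, a⟩` with `t` the result of
  -- `K2` on `⟨p, b⟩`.
  have hpb : TotalRecursive fun z => pairing (fun n => z (2 * n))
      (fun n => z (2 * (2 * n + 1) + 1)) := .pairing (.evens .oracle) (.odds (.odds .oracle))
  have hya := (hK2.comp_total hpb).pairPart (.of_total (.evens (.odds .oracle)))
  obtain ⟨V2, hV2, e2⟩ := hW2.subst (.of_total hpb)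
  obtain ⟨V1, hV1, e1⟩ := hW1.subst hya
  refine ⟨_, _, hV2.or hV1, hya.bind hK1, fun p x hx hd => ?_⟩
  obtain ⟨z, hgd, y, hyg, hzf⟩ := hd
  obtain ⟨C, ⟨b, hb⟩, h2⟩ := h2 p x hx ⟨y, hyg⟩
  have hsol : ∀ b : B, b ∈ C → ∃ t ∈ K2 (pairing p b), ∃ y ∈ RepresentedSpace.δ (X := Y) t,
      y ∈ g x ∧ ∃ D : Set A, D.Nonempty ∧ ∀ q, ∀ v ∈ RepresentedSpace.δ (X := A) q,
        (W1 (pairing t q) ↔ v ∉ D) ∧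
        (v ∈ D → ∃ t' ∈ K1 (pairing t q), ∃ z ∈ RepresentedSpace.δ (X := Z) t', z ∈ f y) := by
    intro b hb
    obtain ⟨t, ht, y, hy, hyg⟩ := (h2 b b (mem_δ_subtype.2 rfl)).2 hb
    -- The domain of `f ∘ g` requires `g x ⊆ dom f`, so `f` has an instance at whichever `y` the
    -- guess `b` produces.
    exact ⟨t, ht, y, hy, hyg, h1 t y hy (hgd hyg)⟩
  choose t ht y hy hyg D hD hsol using hsol
  refine ⟨{v | ∃ hb : v.2 ∈ C, v.1 ∈ D v.2 hb}, ?_, ?_⟩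
  · obtain ⟨a, ha⟩ := hD b hb
    exact ⟨(a, b), hb, ha⟩
  · rintro q ⟨a, b⟩ hv
    rw [mem_δ_prod] at hv
    have hqa := mem_δ_subtype.1 hv.1
    have hqb := mem_δ_subtype.1 hv.2
    have hmem : ∀ hb : b ∈ C, pairing (t b hb) a ∈ pairPart
        (K2 (pairing (fun n => pairing p q (2 * n)) fun n => pairing p q (2 * (2 * n + 1) + 1)))
        (Part.some fun n => pairing p q (2 * (2 * n) + 1)) := by
      intro hb
      simp only [pairing_even, pairing_odd, hqa, hqb]
      exact mem_pairPart (ht b hb) (Part.mem_some _)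
    constructor
    · rw [e2 _ _ (Part.mem_some _)]
      simp only [pairing_even, pairing_odd, hqb]
      rw [(h2 b b (mem_δ_subtype.2 rfl)).1]
      -- For `b ∉ C` the first test already rejects, so it does not matter what `V1` does when `K2`
      -- yields no meaningful name.
      by_cases hb : b ∈ C
      · rw [e1 _ _ (hmem hb), (hsol b hb a a (mem_δ_subtype.2 rfl)).1]
        simp [hb]
      · simp [hb]
    · rintro ⟨hb, ha⟩
      obtain ⟨t', ht', z, hz, hzf⟩ := (hsol b hb a a (mem_δ_subtype.2 rfl)).2 ha
      exact ⟨t', Part.mem_bind (hmem hb) ht', z, hz, hgd, _, hyg b hb, hzf⟩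

/-- Independent choice is available only for subspaces of Baire space, so `V` is traded for an
equivalent `A`. -/
theorem closedUnderComposition_of_le {A : Set (ℕ → ℕ)} {V : Type*} [RepresentedSpace V]
    (hA : WeihrauchLE (closedChoice (A × A)) (closedChoice A))
    (hVA : WeihrauchLE (closedChoice V) (closedChoice A))
    (hAV : WeihrauchLE (closedChoice A) (closedChoice V)) :
    ClosedUnderComposition.{u, v, w} (closedChoice V) := by
  intro X Y Z _ _ _ f g hf hg
  exact ((multiComp_le_closedChoice_prod (hf.trans hVA) (hg.trans hVA)).trans hA).trans hAV

theorem isIdempotentDegree_of_le {A : Set (ℕ → ℕ)} {V : Type*} [RepresentedSpace V]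
    (hA : WeihrauchLE (closedChoice (A × A)) (closedChoice A))
    (hVA : WeihrauchLE (closedChoice V) (closedChoice A))
    (hAV : WeihrauchLE (closedChoice A) (closedChoice V)) :
    IsIdempotentDegree (closedChoice V) :=
  ⟨(((hVA.multiProd hVA).trans multiProd_closedChoice_le).trans hA).trans hAV,
    weihrauchLE_multiProd_self _⟩

/-! ### Computable maps between concrete spaces -/

theorem isComputableMap_of_total {X : Type u} {Y : Type v} [RepresentedSpace X]
    [RepresentedSpace Y] {s : X → Y} {g : (ℕ → ℕ) → ℕ → ℕ} (hg : TotalRecursive g)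
    (h : ∀ p, ∀ x ∈ RepresentedSpace.δ (X := X) p, s x ∈ RepresentedSpace.δ (g p)) :
    IsComputableMap s :=
  ⟨_, .of_total hg, fun p x hx _ => ⟨_, Part.mem_some _, s x, h p x hx, rfl⟩⟩

theorem closedChoice_le_self (X : Type u) [RepresentedSpace X] :
    WeihrauchLE (closedChoice X) (closedChoice X) :=
  closedChoice_le_of_surjective (s := id)
    (isComputableMap_of_total (g := fun p => p) .oracle fun _ _ h => h) Function.surjective_id

/-- The sequences with values in `D`. -/
def sequencesIn (D : Set ℕ) : Set (ℕ → ℕ) := {p | ∀ n, p n ∈ D}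

/-- The sequences, all but the first value of which are in `D`. -/
def tailsIn (D : Set ℕ) : Set (ℕ → ℕ) := {p | ∀ n, p (n + 1) ∈ D}

/-- The sequence with first value `n` and tail `p`. -/
def consSeq (n : ℕ) (p : ℕ → ℕ) : ℕ → ℕ := fun i => if i = 0 then n else p (i - 1)

@[simp] theorem consSeq_zero (n : ℕ) (p : ℕ → ℕ) : consSeq n p 0 = n := rfl

@[simp] theorem consSeq_succ (n : ℕ) (p : ℕ → ℕ) (i : ℕ) : consSeq n p (i + 1) = p i := by
  simp [consSeq]

theorem consSeq_eta (p : ℕ → ℕ) : consSeq (p 0) (fun i => p (i + 1)) = p := by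
  funext i
  cases i <;> simp

theorem consSeq_mem_tailsIn {D : Set ℕ} {n : ℕ} {p : ℕ → ℕ} (hp : ∀ i, p i ∈ D) :
    consSeq n p ∈ tailsIn D := fun i => by simpa using hp i

theorem TotalRecursive.consSeq {a : (ℕ → ℕ) → ℕ} {f : (ℕ → ℕ) → ℕ → ℕ}
    (ha : TotalRecursive fun p (_ : ℕ) => a p) (hf : TotalRecursive f) :
    TotalRecursive fun p => consSeq (a p) (f p) := by
  refine .primrec_comp (f := fun x : ℕ × ℕ × ℕ => if x.1 = 0 then x.2.1 else x.2.2) ?_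
    (.pair .arg (.pair ha (hf.comp (.of_primrec Primrec.pred))))
  exact Primrec.ite (Primrec.eq.comp Primrec.fst (Primrec.const 0))
    (Primrec.fst.comp Primrec.snd) (Primrec.snd.comp Primrec.snd)

theorem TotalRecursive.oracle_const (k : ℕ) : TotalRecursive fun p (_ : ℕ) => p k :=
  .oracle_comp (.of_primrec (Primrec.const k))

theorem TotalRecursive.oracle_succ : TotalRecursive fun p n => p (n + 1) :=
  .oracle_comp (.of_primrec Primrec.succ)

/-! ### Closed choice on the concrete sequence spaces -/

theorem closedChoice_sequencesIn_prod_le (D : Set ℕ) :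
    WeihrauchLE (closedChoice (sequencesIn D × sequencesIn D)) (closedChoice (sequencesIn D)) := by
  let s : sequencesIn D → sequencesIn D × sequencesIn D := fun a =>
    (⟨fun n => a.1 (2 * n), fun n => a.2 _⟩, ⟨fun n => a.1 (2 * n + 1), fun n => a.2 _⟩)
  refine closedChoice_le_of_surjective (s := s)
    -- Splitting into even and odd entries is how product names are read, so the identity realizes
    -- `s`.
    (isComputableMap_of_total (g := fun p => p) .oracle fun p a ha => ?_) ?_
  · obtain rfl := mem_δ_subtype.1 ha
    exact mem_δ_prod.2 ⟨mem_δ_subtype.2 rfl, mem_δ_subtype.2 rfl⟩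
  · rintro ⟨⟨a, ha⟩, b, hb⟩
    refine ⟨⟨pairing a b, fun n => ?_⟩, ?_⟩
    · unfold pairing
      split_ifs
      · exact ha _
      · exact hb _
    · simp only [s, pairing_even, pairing_odd]

/-- The unrestricted heads are merged by `Nat.pair`; the tails must keep values in `D`, so they are
interleaved. -/
theorem closedChoice_tailsIn_prod_le (D : Set ℕ) :
    WeihrauchLE (closedChoice (tailsIn D × tailsIn D)) (closedChoice (tailsIn D)) := by
  let s : tailsIn D → tailsIn D × tailsIn D := fun a =>
    (⟨consSeq (a.1 0).unpair.1 fun n => a.1 (2 * n + 1), consSeq_mem_tailsIn fun n => a.2 _⟩,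
      ⟨consSeq (a.1 0).unpair.2 fun n => a.1 (2 * n + 1 + 1), consSeq_mem_tailsIn fun n => a.2 _⟩)
  refine closedChoice_le_of_surjective (s := s) (isComputableMap_of_total
    (g := fun p => pairing (consSeq (p 0).unpair.1 fun n => p (2 * n + 1))
      (consSeq (p 0).unpair.2 fun n => p (2 * n + 1 + 1))) ?_ fun p a ha => ?_) ?_
  · refine .pairing (.consSeq ?_ (.odds .oracle)) (.consSeq ?_ (.odds .oracle_succ))
    · exact .primrec_comp (f := fun n : ℕ => n.unpair.1) (Primrec.fst.comp Primrec.unpair) (.oracle_const 0)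
    · exact .primrec_comp (f := fun n : ℕ => n.unpair.2) (Primrec.snd.comp Primrec.unpair) (.oracle_const 0)
  · obtain rfl := mem_δ_subtype.1 ha
    exact pairing_mem_δ (mem_δ_subtype.2 rfl) (mem_δ_subtype.2 rfl)
  · rintro ⟨⟨a, ha⟩, b, hb⟩
    refine ⟨⟨consSeq (Nat.pair (a 0) (b 0)) (pairing (fun i => a (i + 1)) fun i => b (i + 1)),
      consSeq_mem_tailsIn fun n => ?_⟩, ?_⟩
    · unfold pairing
      split_ifs
      · exact ha _
      · exact hb _
    · simp only [s, consSeq_succ, consSeq_zero, pairing_even, pairing_odd, Nat.unpair_pair,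
        consSeq_eta]

/-- A natural number has many names; `tailsIn {0}` keeps just one, `n000…`, for each. -/
theorem closedChoice_nat_le : WeihrauchLE (closedChoice ℕ) (closedChoice (tailsIn {0})) := by
  refine closedChoice_le_of_surjective (s := fun a => a.1 0)
    (isComputableMap_of_total (g := fun p => p) .oracle fun p a ha => ?_) fun n => ?_
  · obtain rfl := mem_δ_subtype.1 ha
    exact Part.mem_some _
  · exact ⟨⟨consSeq n fun _ => 0, consSeq_mem_tailsIn fun _ => rfl⟩, rfl⟩

theorem closedChoice_le_nat : WeihrauchLE (closedChoice (tailsIn {0})) (closedChoice ℕ) := by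
  refine closedChoice_le_of_surjective
    (s := fun n => ⟨consSeq n fun _ => 0, consSeq_mem_tailsIn fun _ => rfl⟩)
    (isComputableMap_of_total (g := fun p => consSeq (p 0) fun _ => 0)
      (.consSeq (.oracle_const 0) (.of_primrec (Primrec.const 0))) fun p n hn => ?_) ?_
  · obtain rfl := Part.mem_some_iff.1 hn
    exact mem_δ_subtype.2 rfl
  · rintro ⟨a, ha⟩
    refine ⟨a 0, Subtype.ext (funext fun i => ?_)⟩
    cases i with
    | zero => rfl
    | succ i => simpa using (ha i).symm

theorem closedChoice_baire_le :
    WeihrauchLE (closedChoice (ℕ → ℕ)) (closedChoice (sequencesIn Set.univ)) := by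
  refine closedChoice_le_of_surjective (s := fun a => a.1)
    (isComputableMap_of_total (g := fun p => p) .oracle fun p a ha => ?_)
    fun a => ⟨⟨a, fun _ => trivial⟩, rfl⟩
  obtain rfl := mem_δ_subtype.1 ha
  exact Part.mem_some _

theorem closedChoice_le_baire :
    WeihrauchLE (closedChoice (sequencesIn Set.univ)) (closedChoice (ℕ → ℕ)) := by
  refine closedChoice_le_of_surjective (s := fun a => ⟨a, fun _ => trivial⟩)
    (isComputableMap_of_total (g := fun p => p) .oracle fun p a ha => ?_)
    fun a => ⟨a.1, rfl⟩
  obtain rfl := Part.mem_some_iff.1 ha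
  exact mem_δ_subtype.2 rfl

theorem closedChoice_nat_prod_cantor_le :
    WeihrauchLE (closedChoice (ℕ × Cantor)) (closedChoice (tailsIn {0, 1})) := by
  refine closedChoice_le_of_surjective (s := fun a => (a.1 0, ⟨fun i => a.1 (i + 1), a.2⟩))
    (isComputableMap_of_total (g := fun p => pairing p fun i => p (i + 1))
      (.pairing .oracle .oracle_succ) fun p a ha => ?_) ?_
  · obtain rfl := mem_δ_subtype.1 ha
    exact pairing_mem_δ (Part.mem_some _) (mem_δ_subtype.2 rfl)
  · rintro ⟨n, c, hc⟩
    exact ⟨⟨consSeq n c, consSeq_mem_tailsIn hc⟩, by simp⟩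

theorem closedChoice_le_nat_prod_cantor :
    WeihrauchLE (closedChoice (tailsIn {0, 1})) (closedChoice (ℕ × Cantor)) := by
  refine closedChoice_le_of_surjective
    (s := fun z => ⟨consSeq z.1 z.2.1, consSeq_mem_tailsIn z.2.2⟩)
    (isComputableMap_of_total (g := fun p => consSeq (p 0) fun i => p (2 * i + 1))
      (.consSeq (.oracle_const 0) (.odds .oracle)) ?_) ?_
  · rintro p ⟨n, c⟩ hz
    rw [mem_δ_prod] at hz
    obtain rfl : n = p 0 := Part.mem_some_iff.1 hz.1
    have hc := mem_δ_subtype.1 hz.2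
    refine mem_δ_subtype.2 ?_
    simp only at hc ⊢
    rw [hc]
  · rintro ⟨a, ha⟩
    exact ⟨(a 0, ⟨fun i => a (i + 1), ha⟩), Subtype.ext (consSeq_eta a)⟩

/-! ### Expansions of real numbers -/

/-- The integer with digits `p 0, …, p k` in base `b`. -/
def digitsNum (b : ℕ) (p : ℕ → ℕ) (k : ℕ) : ℕ :=
  Nat.rec (p 0) (fun i N => b * N + p (i + 1)) k

theorem digitsNum_succ (b : ℕ) (p : ℕ → ℕ) (k : ℕ) :
    digitsNum b p (k + 1) = b * digitsNum b p k + p (k + 1) := rfl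

theorem TotalRecursive.digitsNum (b : ℕ) {f : (ℕ → ℕ) → ℕ → ℕ} (hf : TotalRecursive f) :
    TotalRecursive fun p => digitsNum b (f p) := by
  refine .nat_rec (f := fun p => f p 0) (g := fun p yi => b * yi.2 + f p (yi.1 + 1))
    (hf.comp (.of_primrec (Primrec.const 0))) ?_
  exact .primrec₂_comp Primrec.nat_add
    (.of_primrec (Primrec.nat_mul.comp (Primrec.const b) Primrec.snd))
    (hf.comp (.of_primrec (Primrec.succ.comp Primrec.fst)))

/-- The real number with integer part `p 0` and the digits `p 1, p 2, …` in base `b`. -/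
noncomputable def expansion (b : ℕ) (p : ℕ → ℕ) : ℝ :=
  p 0 + ∑' i, (p (i + 1) : ℝ) / (b : ℝ) ^ (i + 1)

/-- Multiplication by `b ^ k` splits the expansion into `digitsNum b p k` and a tail, which is at
most the geometric sum `1 / (b - 1)`. The error is `1` in base 2 but only `1 / 3` in base 4, which
leaves gaps that make digits recoverable. -/
theorem digitsNum_bounds {b : ℕ} (hb : 2 ≤ b) {p : ℕ → ℕ} (hp : ∀ n, p (n + 1) ≤ 1) (k : ℕ) :
    (digitsNum b p k : ℝ) ≤ (b : ℝ) ^ k * expansion b p ∧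
      (b : ℝ) ^ k * expansion b p ≤ digitsNum b p k + 1 / ((b : ℝ) - 1) := by
  have hb' : (2 : ℝ) ≤ b := by exact_mod_cast hb
  have hinv : (b : ℝ)⁻¹ < 1 := inv_lt_one_of_one_lt₀ (by linarith)
  have hgeom : HasSum (fun i : ℕ => (1 : ℝ) / (b : ℝ) ^ (i + 1)) (1 / ((b : ℝ) - 1)) := by
    have h := (hasSum_geometric_of_lt_one (by positivity) hinv).mul_left (b : ℝ)⁻¹
    have e1 : (fun i : ℕ => (1 : ℝ) / (b : ℝ) ^ (i + 1)) = fun i => (b : ℝ)⁻¹ * (b : ℝ)⁻¹ ^ i := by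
      funext i
      rw [pow_succ', inv_pow, one_div, mul_inv]
    have e2 : 1 / ((b : ℝ) - 1) = (b : ℝ)⁻¹ * (1 - (b : ℝ)⁻¹)⁻¹ := by
      have : (b : ℝ) - 1 ≠ 0 := by linarith
      field_simp
    rw [e1, e2]
    exact h
  have hle : ∀ (m i : ℕ), (p (m + i + 1) : ℝ) / (b : ℝ) ^ (i + 1) ≤ 1 / (b : ℝ) ^ (i + 1) := by
    intro m i
    have : (p (m + i + 1) : ℝ) ≤ 1 := by exact_mod_cast hp (m + i)
    gcongr
  have hsum : ∀ m : ℕ, Summable fun i : ℕ => (p (m + i + 1) : ℝ) / (b : ℝ) ^ (i + 1) := fun m =>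
    Summable.of_nonneg_of_le (fun i => by positivity) (hle m) hgeom.summable
  have htail : (b : ℝ) ^ k * expansion b p =
      digitsNum b p k + ∑' i, (p (k + i + 1) : ℝ) / (b : ℝ) ^ (i + 1) := by
    induction k with
    | zero => simp [expansion, digitsNum]
    | succ k ih =>
      have h1 : (b : ℝ) * ∑' i, (p (k + i + 1) : ℝ) / (b : ℝ) ^ (i + 1) =
          p (k + 1) + ∑' i, (p (k + 1 + i + 1) : ℝ) / (b : ℝ) ^ (i + 1) := by
        rw [(hsum k).tsum_eq_zero_add, mul_add, ← tsum_mul_left]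
        congr 1
        · simp only [add_zero, zero_add, pow_one]
          field_simp
        · refine tsum_congr fun i => ?_
          rw [show k + (i + 1) + 1 = k + 1 + i + 1 by ring, pow_succ (b : ℝ) (i + 1)]
          field_simp
      rw [pow_succ', mul_assoc, ih, mul_add, h1, digitsNum_succ]
      push_cast
      ring
  rw [htail]
  have h1 : 0 ≤ ∑' i, (p (k + i + 1) : ℝ) / (b : ℝ) ^ (i + 1) :=
    tsum_nonneg fun i => by positivity
  have h2 : ∑' i, (p (k + i + 1) : ℝ) / (b : ℝ) ^ (i + 1) ≤ 1 / ((b : ℝ) - 1) :=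
    hgeom.tsum_eq ▸ (hsum k).tsum_le_tsum (hle k) hgeom.summable
  constructor <;> linarith

theorem le_one_of_mem_tailsIn {p : ℕ → ℕ} (hp : p ∈ tailsIn {0, 1}) (n : ℕ) : p (n + 1) ≤ 1 := by
  rcases hp n with h | h <;> simp_all

theorem primrec_const_pow (b : ℕ) : Primrec fun n : ℕ => b ^ n :=
  (Primrec₂.unpaired'.1 Nat.Primrec.pow).comp (Primrec.const b) Primrec.id

/-! ### Closed choice on the real numbers -/

theorem IsCauchyName.abs_sub_le {p : ℕ → ℕ} {x : ℝ} (h : IsCauchyName p x) (k : ℕ) :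
    |(ratOfNat (p k) : ℝ) - x| ≤ (1 / 2) ^ k := by
  rw [abs_sub_comm]
  refine le_of_tendsto ((h.2.sub_const _).abs) ?_
  filter_upwards [eventually_gt_atTop k] with i hi using (h.1 i k hi).le

theorem ratOfNat_pair (a b d : ℕ) :
    (ratOfNat (Nat.pair (Nat.pair a b) d) : ℝ) = ((a : ℝ) - b) / (d + 1) := by
  simp [ratOfNat]

theorem ratOfNat_eq (n : ℕ) : (ratOfNat n : ℝ) =
    ((n.unpair.1.unpair.1 : ℝ) - n.unpair.1.unpair.2) / ((n.unpair.2 + 1 : ℕ) : ℝ) := by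
  simp [ratOfNat]

theorem eq_of_forall_abs_sub_le {x y c : ℝ} (h : ∀ k : ℕ, |x - y| ≤ c * (1 / 2) ^ k) : x = y := by
  have h1 : Tendsto (fun k : ℕ => c * (1 / 2 : ℝ) ^ k) atTop (𝓝 (c * 0)) :=
    (tendsto_pow_atTop_nhds_zero_of_lt_one (by norm_num) (by norm_num)).const_mul c
  have h2 := ge_of_tendsto' h1 h
  rw [mul_zero] at h2
  exact sub_eq_zero.1 (abs_eq_zero.1 (le_antisymm h2 (abs_nonneg _)))

/-- The digits of a signed binary expansion: the first value `⟨a, b⟩` codes the integer part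
`a - b`. -/
def binaryDigits (p : ℕ → ℕ) : ℕ → ℕ := consSeq (p 0).unpair.1 fun i => p (i + 1)

/-- The real number with a given signed binary expansion. -/
noncomputable def binaryReal (p : ℕ → ℕ) : ℝ := expansion 2 (binaryDigits p) - (p 0).unpair.2

/-- The dyadic approximations of a signed binary expansion. -/
def binaryName (p : ℕ → ℕ) (k : ℕ) : ℕ :=
  Nat.pair (Nat.pair (digitsNum 2 (binaryDigits p) (k + 1)) ((p 0).unpair.2 * 2 ^ (k + 1)))
    (2 ^ (k + 1) - 1)

theorem totalRecursive_binaryName : TotalRecursive binaryName := by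
  have hpow : TotalRecursive fun (_ : ℕ → ℕ) (k : ℕ) => 2 ^ (k + 1) :=
    .of_primrec ((primrec_const_pow 2).comp Primrec.succ)
  have hdig : TotalRecursive binaryDigits := .consSeq
    (.primrec_comp (f := fun n : ℕ => n.unpair.1) (Primrec.fst.comp Primrec.unpair)
      (.oracle_const 0)) .oracle_succ
  have hb : TotalRecursive fun p (_ : ℕ) => (p 0).unpair.2 :=
    .primrec_comp (f := fun n : ℕ => n.unpair.2) (Primrec.snd.comp Primrec.unpair)
      (.oracle_const 0)
  change TotalRecursive fun p k => Nat.pair (Nat.pair (digitsNum 2 (binaryDigits p) (k + 1))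
    ((p 0).unpair.2 * 2 ^ (k + 1))) (2 ^ (k + 1) - 1)
  exact .primrec₂_comp Primrec₂.natPair
    (.primrec₂_comp Primrec₂.natPair ((hdig.digitsNum 2).comp (.of_primrec Primrec.succ))
      (.primrec₂_comp Primrec.nat_mul hb hpow))
    (.primrec₂_comp Primrec.nat_sub hpow (.of_primrec (Primrec.const 1)))

theorem isCauchyName_binaryName {p : ℕ → ℕ} (hp : p ∈ tailsIn {0, 1}) :
    IsCauchyName (binaryName p) (binaryReal p) := by
  have hq : ∀ n, binaryDigits p (n + 1) ≤ 1 := fun n => by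
    simpa [binaryDigits] using le_one_of_mem_tailsIn hp n
  -- Using `k + 1` digits gives approximations from below with half the allowed error, whence the
  -- strict inequality for Cauchy names.
  have key : ∀ k, (ratOfNat (binaryName p k) : ℝ) ≤ binaryReal p ∧
      binaryReal p ≤ ratOfNat (binaryName p k) + (1 / 2) ^ (k + 1) := by
    intro k
    obtain ⟨h1, h2⟩ := digitsNum_bounds le_rfl hq (k + 1)
    have h2k : (0 : ℝ) < 2 ^ (k + 1) := by positivity
    have he : (ratOfNat (binaryName p k) : ℝ) =
        digitsNum 2 (binaryDigits p) (k + 1) / 2 ^ (k + 1) - (p 0).unpair.2 := by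
      rw [binaryName, ratOfNat_pair, Nat.cast_sub Nat.one_le_two_pow]
      push_cast
      field_simp
      ring
    push_cast at h1 h2
    rw [he, binaryReal]
    constructor
    · rw [sub_le_sub_iff_right, div_le_iff₀ h2k]
      linarith
    · rw [sub_add_eq_add_sub, sub_le_sub_iff_right, one_div_pow, ← add_div, le_div_iff₀ h2k]
      norm_num at h2
      linarith
  have hhalf : ∀ k : ℕ, (1 / 2 : ℝ) ^ (k + 1) = (1 / 2) ^ k / 2 := fun k => by ring
  refine ⟨fun i j hij => ?_, ?_⟩
  · have h1 : (1 / 2 : ℝ) ^ (i + 1) ≤ (1 / 2) ^ (j + 1) :=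
      pow_le_pow_of_le_one (by norm_num) (by norm_num) (by omega)
    have h2 : (0 : ℝ) < (1 / 2) ^ j := by positivity
    have hi := key i
    have hj := key j
    rw [abs_lt]
    constructor <;> linarith [hi.1, hi.2, hj.1, hj.2, hhalf j]
  · rw [tendsto_iff_dist_tendsto_zero]
    refine squeeze_zero (fun _ => dist_nonneg) (fun k => ?_)
      (tendsto_pow_atTop_nhds_zero_of_lt_one (r := (1 / 2 : ℝ)) (by norm_num) (by norm_num))
    have h2 : (0 : ℝ) < (1 / 2) ^ k := by positivity
    rw [Real.dist_eq, abs_le]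
    constructor <;> linarith [(key k).1, (key k).2, hhalf k]

/-- Adding `⌈|x|⌉` makes the number nonnegative, and its digits are the parities of `⌊2 ^ (i + 1) *
y⌋`. -/
theorem exists_binaryReal_eq (x : ℝ) : ∃ p ∈ tailsIn {0, 1}, binaryReal p = x := by
  set b := ⌈|x|⌉₊ with hb
  have hy : 0 ≤ x + b := by linarith [Nat.le_ceil |x|, neg_abs_le x]
  set y := x + b with hyb
  let p : ℕ → ℕ := consSeq (Nat.pair ⌊y⌋₊ b) fun i => ⌊2 ^ (i + 1) * y⌋₊ % 2
  have hp : p ∈ tailsIn {0, 1} := consSeq_mem_tailsIn fun i => by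
    simpa using Nat.mod_two_eq_zero_or_one _
  have hq : ∀ n, binaryDigits p (n + 1) ≤ 1 := fun n => by
    simpa [binaryDigits] using le_one_of_mem_tailsIn hp n
  have hnum : ∀ k, digitsNum 2 (binaryDigits p) k = ⌊2 ^ k * y⌋₊ := by
    intro k
    induction k with
    | zero => simp [digitsNum, binaryDigits, p]
    | succ k ih =>
      have h : ⌊2 ^ (k + 1) * y⌋₊ / 2 = ⌊2 ^ k * y⌋₊ := by
        have := Nat.floor_div_natCast (2 ^ (k + 1) * y) 2
        rw [← this]
        congr 1
        push_cast
        ring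
      rw [digitsNum_succ, ih, ← h]
      simp only [binaryDigits, p, consSeq_succ]
      omega
  refine ⟨p, hp, ?_⟩
  have he : expansion 2 (binaryDigits p) = y := by
    refine eq_of_forall_abs_sub_le (c := 1) fun k => ?_
    obtain ⟨h1, h2⟩ := digitsNum_bounds le_rfl hq k
    rw [hnum k] at h1 h2
    have h3 := Nat.floor_le (show 0 ≤ 2 ^ k * y by positivity)
    have h4 := Nat.lt_floor_add_one (2 ^ k * y)
    push_cast at h1 h2
    norm_num at h2
    have h2k : (0 : ℝ) < 2 ^ k := by positivity
    rw [one_mul, one_div_pow, le_div_iff₀ h2k, ← abs_of_pos h2k, ← abs_mul, abs_le]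
    constructor <;> linarith
  rw [binaryReal, he]
  simp [p, hyb]

/-- Only the passage from expansions to reals has to be computable; in the other direction mere
existence of an expansion suffices. -/
theorem closedChoice_real_le : WeihrauchLE (closedChoice ℝ) (closedChoice (tailsIn {0, 1})) := by
  refine closedChoice_le_of_surjective (s := fun a => binaryReal a)
    (isComputableMap_of_total totalRecursive_binaryName fun p a ha => ?_) fun x => ?_
  · obtain rfl := mem_δ_subtype.1 ha
    exact mem_δ_real.2 (isCauchyName_binaryName a.2)
  · obtain ⟨p, hp, rfl⟩ := exists_binaryReal_eq x
    exact ⟨⟨p, hp⟩, rfl⟩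

/-- The numerator of the rational number with number `n`, as a difference, and the denominator. -/
def ratParts (n : ℕ) : ℕ × ℕ × ℕ := (n.unpair.1.unpair.1, n.unpair.1.unpair.2, n.unpair.2 + 1)

theorem primrec_ratParts : Primrec ratParts := by
  have h := Primrec.unpair.comp (Primrec.fst.comp Primrec.unpair)
  exact (Primrec.fst.comp h).pair ((Primrec.snd.comp h).pair
    (Primrec.succ.comp (Primrec.snd.comp Primrec.unpair)))

/-- The integer nearest to `4 ^ j * x`, where `x` is the rational number with number `n`. -/
def roundScaled (j n : ℕ) : ℕ :=
  (2 * (4 ^ j * (ratParts n).1) + (ratParts n).2.2 - 2 * (4 ^ j * (ratParts n).2.1)) /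
    (2 * (ratParts n).2.2)

theorem primrec_roundScaled : Primrec₂ roundScaled := by
  have hp : Primrec fun x : ℕ × ℕ => 4 ^ x.1 := (primrec_const_pow 4).comp Primrec.fst
  have hr : Primrec fun x : ℕ × ℕ => ratParts x.2 := primrec_ratParts.comp Primrec.snd
  have hd := Primrec.snd.comp (Primrec.snd.comp hr)
  exact Primrec.nat_div.comp (Primrec.nat_sub.comp
    (Primrec.nat_add.comp (Primrec.nat_double.comp (Primrec.nat_mul.comp hp (Primrec.fst.comp hr)))
      hd)
    (Primrec.nat_double.comp (Primrec.nat_mul.comp hp (Primrec.fst.comp (Primrec.snd.comp hr)))))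
    (Primrec.nat_double.comp hd)

/-- `roundScaled` is the floor of `4 ^ j * x + 1 / 2` with denominators cleared; `h1` and `M ≥ 0`
make its truncated subtraction exact. -/
theorem roundScaled_eq {j n M : ℕ} (h1 : (M : ℝ) ≤ 4 ^ j * ratOfNat n + 1 / 2)
    (h2 : 4 ^ j * (ratOfNat n : ℝ) + 1 / 2 < M + 1) : roundScaled j n = M := by
  have hd : (0 : ℝ) < ((ratParts n).2.2 : ℕ) := by
    rw [Nat.cast_pos]
    exact Nat.succ_pos _
  have he : (ratOfNat n : ℝ) = (((ratParts n).1 : ℝ) - (ratParts n).2.1) / ((ratParts n).2.2 : ℕ) :=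
    ratOfNat_eq n
  unfold roundScaled
  generalize (ratParts n).1 = a at *
  generalize (ratParts n).2.1 = b at *
  generalize (ratParts n).2.2 = d at *
  have hmul : (ratOfNat n : ℝ) * d = a - b := by
    rw [he]
    field_simp
  have h1' : M * (2 * d) + 2 * (4 ^ j * b) ≤ 2 * (4 ^ j * a) + d := by
    have : (M : ℝ) * (2 * d) + 2 * (4 ^ j * b) ≤ 2 * (4 ^ j * a) + d := by
      have := mul_le_mul_of_nonneg_right h1 hd.le
      rw [add_mul, mul_assoc, hmul] at this
      linarith
    exact_mod_cast this
  have h2' : 2 * (4 ^ j * a) + d < (M + 1) * (2 * d) + 2 * (4 ^ j * b) := by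
    have : (2 * (4 ^ j * a) + d : ℝ) < (M + 1) * (2 * d) + 2 * (4 ^ j * b) := by
      have := mul_lt_mul_of_pos_right h2 hd
      rw [add_mul, mul_assoc, hmul] at this
      linarith
    exact_mod_cast this
  exact Nat.div_eq_of_lt_le (by omega) (by omega)

/-- The digits of a real number in the range of `expansion 4`, computed from a Cauchy name. -/
def quaternaryDigits (q : ℕ → ℕ) : ℕ → ℕ :=
  consSeq (roundScaled 0 (q 3)) fun i => roundScaled (i + 1) (q (2 * (i + 1) + 3)) % 2

theorem totalRecursive_quaternaryDigits : TotalRecursive quaternaryDigits := by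
  have hadd : Primrec fun i : ℕ => 2 * (i + 1) + 3 :=
    Primrec.nat_add.comp (Primrec.nat_double.comp Primrec.succ) (Primrec.const 3)
  refine .consSeq ?_ ?_
  · exact .primrec₂_comp primrec_roundScaled (.of_primrec (Primrec.const 0)) (.oracle_const 3)
  · exact .primrec₂_comp Primrec.nat_mod (.primrec₂_comp primrec_roundScaled
      (.of_primrec Primrec.succ) (.oracle_comp (.of_primrec hadd))) (.of_primrec (Primrec.const 2))

theorem quaternaryDigits_mem (q : ℕ → ℕ) : quaternaryDigits q ∈ tailsIn {0, 1} :=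
  consSeq_mem_tailsIn fun i => by simpa using Nat.mod_two_eq_zero_or_one _

theorem quaternaryDigits_eq {p q : ℕ → ℕ} (hp : p ∈ tailsIn {0, 1})
    (hq : IsCauchyName q (expansion 4 p)) : quaternaryDigits q = p := by
  have key : ∀ j, roundScaled j (q (2 * j + 3)) = digitsNum 4 p j := by
    intro j
    obtain ⟨h1, h2⟩ := digitsNum_bounds (b := 4) (by norm_num) (le_one_of_mem_tailsIn hp) j
    push_cast at h1 h2
    norm_num at h2
    have h3 := mul_le_mul_of_nonneg_left (hq.abs_sub_le (2 * j + 3))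
      (show (0 : ℝ) ≤ 4 ^ j by positivity)
    -- Index `2 * j + 3` makes the scaled error at most `1 / 8`; with a tail of at most `1 / 3` the
    -- total stays below `1 / 2`, so rounding is correct.
    have h4 : (4 : ℝ) ^ j * (1 / 2) ^ (2 * j + 3) = 1 / 8 := by
      rw [pow_add, pow_mul, ← mul_assoc, ← mul_pow]
      norm_num
    rw [h4, ← abs_of_pos (show (0 : ℝ) < 4 ^ j by positivity), ← abs_mul,
      mul_sub, abs_le] at h3
    apply roundScaled_eq <;> linarith [h3.1, h3.2]
  funext i
  cases i with
  | zero => exact key 0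
  | succ i =>
    have h1 := le_one_of_mem_tailsIn hp i
    -- The new digit is the remainder modulo 2, since `4 * N` is even and the digit is at most `1`.
    rw [quaternaryDigits, consSeq_succ, key, digitsNum_succ]
    omega

/-- The test `|x - N / 4 ^ k| > 2 / 2 ^ k`, where `x` is the rational number with number `n`. -/
def IsFar (k n N : ℕ) : Prop :=
  4 ^ k * (ratParts n).2.1 + (N + 2 * 2 ^ k) * (ratParts n).2.2 < 4 ^ k * (ratParts n).1 ∨
    4 ^ k * (ratParts n).1 + 2 * 2 ^ k * (ratParts n).2.2 <
      4 ^ k * (ratParts n).2.1 + N * (ratParts n).2.2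

instance (k n N : ℕ) : Decidable (IsFar k n N) :=
  inferInstanceAs (Decidable (_ ∨ _))

theorem primrec_isFar : PrimrecPred fun x : ℕ × ℕ × ℕ => IsFar x.1 x.2.1 x.2.2 := by
  have h4 : Primrec fun x : ℕ × ℕ × ℕ => 4 ^ x.1 := (primrec_const_pow 4).comp Primrec.fst
  have h2 : Primrec fun x : ℕ × ℕ × ℕ => 2 * 2 ^ x.1 :=
    Primrec.nat_double.comp ((primrec_const_pow 2).comp Primrec.fst)
  have hr : Primrec fun x : ℕ × ℕ × ℕ => ratParts x.2.1 :=
    primrec_ratParts.comp (Primrec.fst.comp Primrec.snd)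
  have hN : Primrec fun x : ℕ × ℕ × ℕ => x.2.2 := Primrec.snd.comp Primrec.snd
  have ha := Primrec.nat_mul.comp h4 (Primrec.fst.comp hr)
  have hb := Primrec.nat_mul.comp h4 (Primrec.fst.comp (Primrec.snd.comp hr))
  have hd := Primrec.snd.comp (Primrec.snd.comp hr)
  exact (Primrec.nat_lt.comp
      (Primrec.nat_add.comp hb (Primrec.nat_mul.comp (Primrec.nat_add.comp hN h2) hd)) ha).or
    (Primrec.nat_lt.comp (Primrec.nat_add.comp ha (Primrec.nat_mul.comp h2 hd))
      (Primrec.nat_add.comp hb (Primrec.nat_mul.comp hN hd)))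

/-- The alternatives of `IsFar` are the two signs in the absolute value, multiplied by `4 ^ k` times
the denominator, with subtractions moved across. -/
theorem isFar_iff {k n N : ℕ} :
    IsFar k n N ↔ 2 * (1 / 2) ^ k < |(ratOfNat n : ℝ) - N / 4 ^ k| := by
  have hd : (0 : ℝ) < ((ratParts n).2.2 : ℕ) := by
    rw [Nat.cast_pos]
    exact Nat.succ_pos _
  have he : (ratOfNat n : ℝ) = (((ratParts n).1 : ℝ) - (ratParts n).2.1) / ((ratParts n).2.2 : ℕ) :=
    ratOfNat_eq n
  unfold IsFar
  generalize (ratParts n).1 = a at *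
  generalize (ratParts n).2.1 = b at *
  generalize (ratParts n).2.2 = d at *
  have h4 : (0 : ℝ) < 4 ^ k := by positivity
  have hpos : (0 : ℝ) < 4 ^ k * d := mul_pos h4 hd
  have e1 : (4 ^ k * d : ℝ) * (ratOfNat n - N / 4 ^ k) = 4 ^ k * a - 4 ^ k * b - N * d := by
    rw [he]
    field_simp
  have e2 : (4 ^ k * d : ℝ) * (2 * (1 / 2) ^ k) = 2 * 2 ^ k * d := by
    rw [show (4 : ℝ) ^ k = 2 ^ k * 2 ^ k by rw [← mul_pow]; norm_num, one_div_pow]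
    field_simp
  rw [← mul_lt_mul_iff_right₀ hpos, e2, ← abs_of_pos hpos, ← abs_mul, e1, lt_abs, ← Nat.cast_lt (α := ℝ), ← Nat.cast_lt (α := ℝ)]
  push_cast
  refine or_congr ?_ ?_ <;> constructor <;> intro h <;> linarith

/-- Both approximations have error at most `(1 / 2) ^ k`. Equal reals are therefore never far, and
reals that are never far differ by at most `4 * (1 / 2) ^ k` for all `k`. -/
theorem exists_isFar_iff {q : ℕ → ℕ} {x : ℝ} (hq : IsCauchyName q x) {p : ℕ → ℕ}
    (hp : p ∈ tailsIn {0, 1}) : (∃ k, IsFar k (q k) (digitsNum 4 p k)) ↔ x ≠ expansion 4 p := by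
  have hdist : ∀ k, |expansion 4 p - digitsNum 4 p k / 4 ^ k| ≤ (1 / 2) ^ k := by
    intro k
    obtain ⟨h1, h2⟩ := digitsNum_bounds (b := 4) (by norm_num) (le_one_of_mem_tailsIn hp) k
    push_cast at h1 h2
    norm_num at h2
    have h4 : (0 : ℝ) < 4 ^ k := by positivity
    have h24 : (1 : ℝ) ≤ 4 ^ k * (1 / 2) ^ k := by
      rw [← mul_pow]
      exact one_le_pow₀ (by norm_num)
    have e : (4 : ℝ) ^ k * (expansion 4 p - digitsNum 4 p k / 4 ^ k) =
        4 ^ k * expansion 4 p - digitsNum 4 p k := by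
      field_simp
    rw [← mul_le_mul_iff_right₀ h4, ← abs_of_pos h4, ← abs_mul, abs_of_pos h4, e, abs_le]
    constructor <;> linarith
  simp only [isFar_iff]
  constructor
  · rintro ⟨k, hk⟩ rfl
    have h1 := hq.abs_sub_le k
    have h2 := abs_sub_le (ratOfNat (q k) : ℝ) (expansion 4 p) (digitsNum 4 p k / 4 ^ k)
    linarith [hdist k]
  · intro hne
    by_contra! h
    refine hne (eq_of_forall_abs_sub_le (c := 4) fun k => ?_)
    have h1 := hq.abs_sub_le k
    have h2 := abs_sub_le x (ratOfNat (q k) : ℝ) (expansion 4 p)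
    have h3 := abs_sub_le (ratOfNat (q k) : ℝ) (digitsNum 4 p k / 4 ^ k) (expansion 4 p)
    have h4 := hdist k
    rw [abs_sub_comm] at h1 h4
    linarith [h k]

/-- Digit extraction yields a point of `tailsIn {0, 1}` from any sequence. So a real is in the range
iff it equals the expansion of its extracted digits, and inequality of reals is semidecidable. -/
theorem closedChoice_le_real : WeihrauchLE (closedChoice (tailsIn {0, 1})) (closedChoice ℝ) := by
  have hT : TotalRecursive fun q k =>
      if IsFar k (q k) (digitsNum 4 (quaternaryDigits q) k) then 0 else 1 :=
    .primrec_comp (f := fun x : ℕ × ℕ × ℕ => if IsFar x.1 x.2.1 x.2.2 then 0 else 1)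
      (Primrec.ite primrec_isFar (Primrec.const 0) (Primrec.const 1))
      (.pair .arg (.pair .oracle (totalRecursive_quaternaryDigits.digitsNum 4)))
  refine closedChoice_le_of_embedding (ι := fun a => expansion 4 a.1)
    (.of_total totalRecursive_quaternaryDigits) (.of_total hT) (fun q a ha => ?_) fun q x hx => ?_
  · exact ⟨_, Part.mem_some _,
      mem_δ_subtype.2 (quaternaryDigits_eq a.2 (mem_δ_real.1 ha))⟩
  · rw [mem_δ_real] at hx
    simp only [ite_eq_left_iff, one_ne_zero, imp_false, not_not]
    rw [exists_isFar_iff hx (quaternaryDigits_mem q)]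
    constructor
    · rintro hne ⟨a, rfl⟩
      exact hne (by rw [quaternaryDigits_eq a.2 hx])
    · rintro hr rfl
      exact hr ⟨⟨_, quaternaryDigits_mem q⟩, rfl⟩

end Weihrauch

theorem mainTheorem3 :
    -- independent choice
    (∀ (A B : Set (ℕ → ℕ)) (X : Type u) (Y : Type v) (Z : Type w)
      [RepresentedSpace X] [RepresentedSpace Y] [RepresentedSpace Z]
      (f : Y → Set Z) (g : X → Set Y),
      WeihrauchLE f (closedChoice A) → WeihrauchLE g (closedChoice B) →
        WeihrauchLE (multiComp f g) (closedChoice (A × B))) ∧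
    -- closure under composition
    (∀ A : Set (ℕ → ℕ),
      (∃ s : A → A × A, IsComputableMap s ∧ Function.Surjective s) →
        WeihrauchLE (closedChoice (A × A)) (closedChoice A) ∧
        ClosedUnderComposition.{u, v, w} (closedChoice A) ∧
        IsIdempotentDegree (closedChoice A)) ∧
    -- special cases
    (ClosedUnderComposition.{u, v, w} (closedChoice ℕ) ∧
      IsIdempotentDegree (closedChoice ℕ)) ∧
    (ClosedUnderComposition.{u, v, w} (closedChoice Cantor) ∧
      IsIdempotentDegree (closedChoice Cantor)) ∧
    (ClosedUnderComposition.{u, v, w} (closedChoice (ℕ → ℕ)) ∧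
      IsIdempotentDegree (closedChoice (ℕ → ℕ))) ∧
    (ClosedUnderComposition.{u, v, w} (closedChoice (ℕ × Cantor)) ∧
      IsIdempotentDegree (closedChoice (ℕ × Cantor))) ∧
    (ClosedUnderComposition.{u, v, w} (closedChoice ℝ) ∧
      IsIdempotentDegree (closedChoice ℝ)) := by
  -- `Cantor` unfolds to `sequencesIn {0, 1}`.
  have hC : WeihrauchLE (closedChoice (Cantor × Cantor)) (closedChoice Cantor) :=
    closedChoice_sequencesIn_prod_le {0, 1}
  have h0 := closedChoice_tailsIn_prod_le {0}
  have h01 := closedChoice_tailsIn_prod_le {0, 1}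
  have hU := closedChoice_sequencesIn_prod_le Set.univ
  refine ⟨fun A B X Y Z _ _ _ f g hf hg => multiComp_le_closedChoice_prod hf hg, ?_,
    ⟨closedUnderComposition_of_le h0 closedChoice_nat_le closedChoice_le_nat,
      isIdempotentDegree_of_le h0 closedChoice_nat_le closedChoice_le_nat⟩,
    ⟨closedUnderComposition_of_le hC (closedChoice_le_self _) (closedChoice_le_self _),
      isIdempotentDegree_of_le hC (closedChoice_le_self _) (closedChoice_le_self _)⟩,
    ⟨closedUnderComposition_of_le hU closedChoice_baire_le closedChoice_le_baire,
      isIdempotentDegree_of_le hU closedChoice_baire_le closedChoice_le_baire⟩,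
    ⟨closedUnderComposition_of_le h01 closedChoice_nat_prod_cantor_le
        closedChoice_le_nat_prod_cantor,
      isIdempotentDegree_of_le h01 closedChoice_nat_prod_cantor_le
        closedChoice_le_nat_prod_cantor⟩,
    ⟨closedUnderComposition_of_le h01 closedChoice_real_le closedChoice_le_real,
      isIdempotentDegree_of_le h01 closedChoice_real_le closedChoice_le_real⟩⟩
  rintro A ⟨s, hs, hsurj⟩
  have hA := closedChoice_le_of_surjective hs hsurj
  exact ⟨hA, closedUnderComposition_of_le hA (closedChoice_le_self _) (closedChoice_le_self _),
    isIdempotentDegree_of_le hA (closedChoice_le_self _) (closedChoice_le_self _)⟩
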